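/- **Setting.** Unit-time jobs are the vertices of a directed acyclic graph; an edge $(u,v)$ means that $v$ depends on $u$. There are $M\ge 1$ identical machines, time slots $1,2,\dots$, and an integer communication delay $\rho>1$. A schedule is a set of triples (machine, job, time slot); a job may be run several times. It is feasible for $H=(V_H,E_H)$ if only jobs of $H$ are run, every job of $H$ is run at least once, a machine runs at most one job per slot, and whenever $v$ is run on machine $m$ in slot $t$, each $u$ with $(u,v)\in E_H$ is run on $m$ in a slot $<t$ or on some machine in a slot $<t-\rho$. For a graph $H$ let $A_H(v)$ be the set of ancestors of $v\in V_H$ in $H$, including $v$ (and $A_H(v)=\emptyset$ for $v\notin V_H$), $A_H(S)=\bigcup_{v\in S}A_H(v)$, and let $E_H(v)$, $E_H(S)$ be the sets of edges of $H$ induced by $A_H(v)$, $A_H(S)$. **Estimates.** Let $n$ be the number of vertices of the main graph, of which $H$ is a subgraph. Cardinalities are estimated by the count-distinct estimator with $k$ hash functions and trees of size $t$: draw $k$ independent uniform members of a 2-universal family (any two distinct elements have independent, uniform hash values in $\{1,\dots,U^3\}$; $U=n$ for vertices and $U=n^2$ for edges). For a set $S$ and each hash function keep the $t$ smallest distinct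 hash values of elements of $S$; its estimate is $tU^3/\ell$, where $\ell$ is the largest value kept, or the number of values kept if there are fewer than $t$. The estimate of $|S|$ is the median over the $k$ hash functions. "Obtaining estimates in $H$" means drawing fresh hash functions, one $k$-tuple for vertices and one for edges, and computing the estimates $a_H(v)$ of $|A_H(v)|$ and $e_H(v)$ of $|E_H(v)|$ for all $v$. **FindBatch**$(H,\gamma)$, with a sampling threshold $N\ge1$. Obtain estimates in $H$. Put $v\in V_H$ in bucket $K_i$ if $2^i\le e_H(v)<2^{i+1}$, and in the smallest bucket $K_1$ if $e_H(v)<4$. Start with $B=\emptyset$. While some bucket is non-empty: (i) for $i$ from the largest bucket index down to $1$, repeatedly remove a uniformly random vertex $v$ from $K_i$, until $K_i$ is empty or $N$ consecutive samples from it were stale; $v$ is added to $B$ if it is *fresh*, i.e. $|A_H(v)\setminus A_H(B)|>\gamma|A_H(v)|$ and [$E_H(v)=\emptyset$ or $|E_H(v)\setminus E_H(B)|>\gamma|E_H(v)|$], and is *stale* otherwise; (ii) prune: with $H'=H\setminus A_H(B)$, obtain estimates in $H$ and in $H'$, and remove from the buckets each $v$ with $a_{H'}(v)/a_H(v)\le2\gamma$,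 or with $E_H(v)\ne\emptyset$ and $e_{H'}(v)/e_H(v)\le2\gamma$. Return $B$. **ScheduleSmallSubgraph**$(H,\gamma)$. While $H\ne\emptyset$: let $B=$ FindBatch$(H,\gamma)$; list schedule the sets $A_H(v)$, $v\in B$ (one after the other, each $A_H(v)$ is run as one unit, in topological order and with duplication, on a machine that becomes free first); insert $\rho$ idle slots on all machines; delete $A_H(B)$ and all adjacent edges from $H$. The length of the schedule is the total number of slots, including the idle slots after each batch. **Lemma.** There is a constant $t_0$, and for every constant $c\ge1$ a constant $\kappa_0$, such that the following holds whenever $t\ge t_0$, the number of hash functions is at least $\kappa_0\ln n$, and $N\ge1$. Let $M\ge1$, let $\rho>1$ be an integer, let $\frac1{16\rho^2}\le\gamma<\frac14$, and let $H=(V_H,E_H)$ be a small subgraph with $|V_H|\le n$, i.e. a finite directed acyclic graph with $|A_H(v)|\le2\rho$ for all $v\in V_H$. Then with probability at least $1-n^{-c}$ ScheduleSmallSubgraph$(H,\gamma)$ produces a feasible schedule of $H$ on $M$ machines of length at most $$\frac{|V_H|}{\gamma M}+12\,\rho\,\log_{1/4\gamma}(2\rho),$$ where $\log_{1/4\gamma}$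 is the logarithm to the base $1/(4\gamma)$. -/

import Mathlib

noncomputable section

namespace CommDelay

/-! ### Finite directed graphs -/

/-- A finite directed graph whose vertices are drawn from `V`. -/
structure FinDigraph (V : Type*) where
  verts : Finset V
  edges : Finset (V × V)
  edges_sub : ∀ e ∈ edges, e.1 ∈ verts ∧ e.2 ∈ verts

namespace FinDigraph

variable {V : Type*} [DecidableEq V]

/-- `u → v` is an edge (job `v` depends on job `u`). -/
def Adj (H : FinDigraph V) (u v : V) : Prop := (u, v) ∈ H.edges

/-- There is no directed cycle. -/
def Acyclic (H : FinDigraph V) : Prop := ∀ v, ¬ Relation.TransGen H.Adj v v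

open Classical in
/-- The ancestors of `v` in `H`, including `v` itself when `v` is a vertex of `H`
(and empty when it is not). -/
def anc (H : FinDigraph V) (v : V) : Finset V :=
  H.verts.filter fun u => Relation.ReflTransGen H.Adj u v

/-- The ancestors of a set of vertices. -/
def ancSet (H : FinDigraph V) (S : Finset V) : Finset V := S.biUnion H.anc

/-- The edges of the subgraph induced by `S`. -/
def inducedEdges (H : FinDigraph V) (S : Finset V) : Finset (V × V) :=
  H.edges.filter fun e => e.1 ∈ S ∧ e.2 ∈ S

/-- The edges of the subgraph induced by the ancestors of `v`. -/
def ancEdges (H : FinDigraph V) (v : V) : Finset (V × V) := H.inducedEdges (H.anc v)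

/-- The edges of the subgraph induced by the ancestors of a set. -/
def ancEdgesSet (H : FinDigraph V) (S : Finset V) : Finset (V × V) :=
  H.inducedEdges (H.ancSet S)

/-- Remove the vertices in `S` and all edges adjacent to them. -/
def delete (H : FinDigraph V) (S : Finset V) : FinDigraph V where
  verts := H.verts \ S
  edges := H.edges.filter fun e => e.1 ∉ S ∧ e.2 ∉ S
  edges_sub := by
    intro e he
    rw [Finset.mem_filter] at he
    have h := H.edges_sub e he.1
    exact ⟨Finset.mem_sdiff.2 ⟨h.1, he.2.1⟩, Finset.mem_sdiff.2 ⟨h.2, he.2.2⟩⟩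

/-- Every vertex has at most `2ρ` ancestors (itself included). -/
def IsSmall (H : FinDigraph V) (ρ : ℕ) : Prop := ∀ v ∈ H.verts, (H.anc v).card ≤ 2 * ρ

/-- The ancestors of `v` in a topological order: in an acyclic graph a proper ancestor of `w`
has strictly fewer ancestors than `w`, so sorting by the number of ancestors is one. -/
def ancList (H : FinDigraph V) (v : V) : List V :=
  (H.anc v).toList.mergeSort fun a b => decide ((H.anc a).card ≤ (H.anc b).card)

end FinDigraph

/-! ### Schedules

Machines are the elements of `Fin M`; time slots are the integers `1, 2, …`. A schedule is a
set of triples `(m, v, t)`: job `v` is run on machine `m` in time slot `t`. -/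

/-- Feasibility of a schedule (duplication allowed) with communication delay `ρ`. -/
structure Feasible {V : Type*} {M : ℕ} (H : FinDigraph V) (ρ : ℕ)
    (σ : Finset (Fin M × V × ℕ)) : Prop where
  /-- only jobs of `H` are run, and in positive time slots -/
  mem : ∀ m v t, (m, v, t) ∈ σ → v ∈ H.verts ∧ 1 ≤ t
  /-- every job is run at least once -/
  covers : ∀ v ∈ H.verts, ∃ m t, (m, v, t) ∈ σ
  /-- a machine runs at most one job in a time slot -/
  exclusive : ∀ m v w t, (m, v, t) ∈ σ → (m, w, t) ∈ σ → v = w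
  /-- each predecessor has been completed on the same machine before time `t`, or on some
  machine before time `t - ρ` -/
  precedence : ∀ m v t, (m, v, t) ∈ σ → ∀ u, H.Adj u v →
    (∃ t', t' < t ∧ (m, u, t') ∈ σ) ∨ (∃ m' t', t' + ρ < t ∧ (m', u, t') ∈ σ)

/-- The completion time of the last job. -/
def makespan {V : Type*} {M : ℕ} (σ : Finset (Fin M × V × ℕ)) : ℕ := σ.sup fun e => e.2.2

/-! ### The count-distinct estimator -/

/-- A (strongly) 2-universal family of hash functions: a uniformly random member maps any two
distinct elements to independent uniform elements of the `N`-element range. -/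
structure HashFamily (α : Type*) (N : ℕ) where
  funcs : Finset (α → Fin N)
  nonempty : funcs.Nonempty
  universal : ∀ x y : α, x ≠ y → ∀ a b : Fin N,
    (funcs.filter fun h => h x = a ∧ h y = b).card * N ^ 2 = funcs.card

/-- The tree kept for the hash function `h` after the elements of `S` were inserted: the `t`
smallest hash values, where the range of `h` is read as `{1, …, N}`. -/
def hashTree {α : Type*} {N : ℕ} (t : ℕ) (h : α → Fin N) (S : Finset α) : Finset ℕ :=
  (((S.image fun a => (h a : ℕ) + 1).sort (· ≤ ·)).take t).toFinset

/-- The estimate read off one tree: `t * N / ℓ` with `ℓ` the largest value kept; a tree that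
holds fewer than `t` values has kept all of them and returns their number. -/
def treeEstimate (t N : ℕ) (T : Finset ℕ) : ℝ :=
  if T.card < t then (T.card : ℝ) else (t : ℝ) * N / (T.sup id : ℕ)

/-- The median of a finite list of reals (the upper one if the length is even). -/
def median (l : List ℝ) : ℝ :=
  (l.mergeSort fun a b => decide (a ≤ b)).getD (l.length / 2) 0

/-- The estimate of the number of elements of `S`: the median over the hash functions. -/
def countEstimate {α : Type*} {N K : ℕ} (t : ℕ) (hs : Fin K → α → Fin N) (S : Finset α) : ℝ :=
  median (List.ofFn fun j => treeEstimate t N (hashTree t (hs j) S))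

/-- `K` hash functions drawn independently and uniformly from the family. -/
def drawHashes {α : Type*} {N : ℕ} (F : HashFamily α N) (K : ℕ) : PMF (Fin K → α → Fin N) :=
  PMF.uniformOfFinset (Fintype.piFinset fun _ : Fin K => F.funcs)
    (Fintype.piFinset_nonempty.2 fun _ => F.nonempty)

/-- The parameters of the estimator. With `n = |V|`, there are at most `n` vertices and at most
`n ^ 2` edges to be counted, and the hash range is the cube of this bound. -/
structure EstimatorParams (V : Type*) [Fintype V] where
  /-- number of hash values kept in a tree -/
  treeSize : ℕ
  /-- number of hash functions (trees) -/
  numHashes : ℕ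
  vertHash : HashFamily V (Fintype.card V ^ 3)
  edgeHash : HashFamily (V × V) ((Fintype.card V ^ 2) ^ 3)

section Algorithm

variable {V : Type*} [Fintype V] [DecidableEq V]

/-- Obtain estimates, for all `v` at once and with fresh hash functions, of the number of
ancestors of `v` (first component) and of the number of edges induced by the ancestors of `v`
(second component). Merging two trees for the same hash function keeps the `t` smallest values
of their union, so passing the trees along the edges in topological order gives `v` exactly the
trees of its ancestor set and of its set of ancestor edges. -/
def obtainEstimates (P : EstimatorParams V) (H : FinDigraph V) : PMF ((V → ℝ) × (V → ℝ)) :=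
  (drawHashes P.vertHash P.numHashes).bind fun hv =>
  (drawHashes P.edgeHash P.numHashes).bind fun he =>
  PMF.pure (fun v => countEstimate P.treeSize hv (H.anc v),
    fun v => countEstimate P.treeSize he (H.ancEdges v))

/-! ### FindBatch -/

/-- `v` is fresh for the current batch `B`. The condition on edges is void for a vertex without
ancestor edges. -/
def Fresh (H : FinDigraph V) (γ : ℝ) (B : List V) (v : V) : Prop :=
  γ * (H.anc v).card < (H.anc v \ H.ancSet B.toFinset).card ∧
  (H.ancEdges v = ∅ ∨
    γ * (H.ancEdges v).card < (H.ancEdges v \ H.ancEdgesSet B.toFinset).card)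

/-- The bucket of a vertex with edge estimate `e`: the `i` with `2 ^ i ≤ e < 2 ^ (i + 1)`, where
estimates that are too small for this go to the smallest bucket, number `1`. -/
def bucketIndex (e : ℝ) : ℕ := max 1 (Nat.log 2 ⌊e⌋₊)

open Classical in
/-- Sample from the bucket `K`, without replacement, until `N` consecutive samples were stale or
the bucket is empty; `s` counts the current run of stale samples. The first argument bounds the
number of samples; `K.card` is enough, as every sample is removed from `K`. Returns what is left
of the bucket, and the batch (in order of insertion). -/
def sampleBucket (H : FinDigraph V) (γ : ℝ) (N : ℕ) :
    ℕ → ℕ → Finset V → List V → PMF (Finset V × List V)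
  | 0, _, K, B => PMF.pure (K, B)
  | fuel + 1, s, K, B =>
    if h : s < N ∧ K.Nonempty then
      (PMF.uniformOfFinset K h.2).bind fun v =>
        if Fresh H γ B v then sampleBucket H γ N fuel 0 (K.erase v) (B ++ [v])
        else sampleBucket H γ N fuel (s + 1) (K.erase v) B
    else PMF.pure (K, B)

/-- The `for` loop over the buckets `i, i - 1, …, 1`. -/
def sweepBuckets (H : FinDigraph V) (γ : ℝ) (N : ℕ) :
    ℕ → (ℕ → Finset V) → List V → PMF ((ℕ → Finset V) × List V)
  | 0, K, B => PMF.pure (K, B)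
  | i + 1, K, B =>
    (sampleBucket H γ N (K (i + 1)).card 0 (K (i + 1)) B).bind fun r =>
      sweepBuckets H γ N i (Function.update K (i + 1) r.1) r.2

open Classical in
/-- Prune the buckets. The test on edges is skipped for a vertex without ancestor edges. -/
def prune (P : EstimatorParams V) (H : FinDigraph V) (γ : ℝ) (B : List V)
    (K : ℕ → Finset V) : PMF (ℕ → Finset V) :=
  (obtainEstimates P H).bind fun e =>
  (obtainEstimates P (H.delete (H.ancSet B.toFinset))).bind fun e' =>
  PMF.pure fun i => (K i).filter fun v =>
    ¬ (e'.1 v / e.1 v ≤ 2 * γ ∨ (H.ancEdges v ≠ ∅ ∧ e'.2 v / e.2 v ≤ 2 * γ))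

open Classical in
/-- The `while` loop of FindBatch over the buckets `1, …, k`. The first argument bounds the number
of rounds; the number of vertices is enough, as every round removes at least one vertex
(for `N ≥ 1`). -/
def batchLoop (P : EstimatorParams V) (H : FinDigraph V) (γ : ℝ) (N k : ℕ) :
    ℕ → (ℕ → Finset V) → List V → PMF (List V)
  | 0, _, B => PMF.pure B
  | fuel + 1, K, B =>
    if ∃ i ∈ Finset.Icc 1 k, (K i).Nonempty then
      (sweepBuckets H γ N k K B).bind fun r =>
      (prune P H γ r.2 r.1).bind fun K' =>
      batchLoop P H γ N k fuel K' r.2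
    else PMF.pure B

/-- FindBatch: the batch, listed in order of insertion. Here `k` is the largest index of a
non-empty bucket. -/
def findBatch (P : EstimatorParams V) (H : FinDigraph V) (γ : ℝ) (N : ℕ) : PMF (List V) :=
  (obtainEstimates P H).bind fun e =>
    batchLoop P H γ N (H.verts.sup fun v => bucketIndex (e.2 v)) H.verts.card
      (fun i => H.verts.filter fun v => bucketIndex (e.2 v) = i) []

/-! ### List scheduling -/

/-- A machine with the smallest load. -/
def leastLoaded {M : ℕ} [NeZero M] (load : Fin M → ℕ) : Fin M :=
  Classical.choose (Finite.exists_min load)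

/-- Run the jobs of the list `l` one after the other on machine `m`, from slot `start + 1` on. -/
def placeList {M : ℕ} (m : Fin M) (start : ℕ) (l : List V) : Finset (Fin M × V × ℕ) :=
  (l.zipIdx.map fun p => (m, p.1, start + p.2 + 1)).toFinset

/-- Greedy list scheduling: for each `v` of the list in turn, the ancestors of `v` are run as one
unit on a machine that becomes free first; `free m` is the last slot in use on machine `m`. -/
def listSchedule {M : ℕ} [NeZero M] (H : FinDigraph V) :
    List V → (Fin M → ℕ) → Finset (Fin M × V × ℕ) × (Fin M → ℕ)
  | [], free => (∅, free)
  | v :: B, free =>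
    let m := leastLoaded free
    let r := listSchedule H B (Function.update free m (free m + (H.anc v).card))
    (placeList m (free m) (H.ancList v) ∪ r.1, r.2)

/-! ### ScheduleSmallSubgraph -/

open Classical in
/-- The `while` loop of ScheduleSmallSubgraph, with the schedule `σ` built so far and its length
`T`. After each batch `ρ` idle slots are inserted. The first argument bounds the number of
batches; the number of vertices is enough, as every batch removes at least one vertex. -/
def scheduleLoop {M : ℕ} [NeZero M] (P : EstimatorParams V) (ρ : ℕ) (γ : ℝ) (N : ℕ) :
    ℕ → FinDigraph V → Finset (Fin M × V × ℕ) → ℕ → PMF (Finset (Fin M × V × ℕ) × ℕ)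
  | 0, _, σ, T => PMF.pure (σ, T)
  | fuel + 1, H, σ, T =>
    if H.verts.Nonempty then
      (findBatch P H γ N).bind fun B =>
        scheduleLoop P ρ γ N fuel (H.delete (H.ancSet B.toFinset))
          (σ ∪ (listSchedule H B fun _ : Fin M => T).1)
          ((Finset.univ.sup (listSchedule H B fun _ : Fin M => T).2) + ρ)
    else PMF.pure (σ, T)

/-- ScheduleSmallSubgraph on `M` machines: the random schedule and its length, in which the idle
time after each batch, the last one included, is counted. -/
def scheduleSmallSubgraph (M : ℕ) [NeZero M] (P : EstimatorParams V) (ρ : ℕ) (γ : ℝ) (N : ℕ)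
    (H : FinDigraph V) : PMF (Finset (Fin M × V × ℕ) × ℕ) :=
  scheduleLoop P ρ γ N H.verts.card H ∅ 0

end Algorithm

end CommDelay

end

/-! The argument splits into a probabilistic half and a deterministic half.

Probability. One random hash function yields an estimate within the factors 2/3 and 4/3 except with
probability at most 3/10: collisions cost at most 1/4 because the range is the cube of the size
bound, and two applications of Chebyshev's inequality locate the `t`-th smallest hash value
(`HashFamily.card_bad_le`). The median of `K` independent estimates is then bad with probability at
most `(11/12)^K` (`card_half_bad_le`). A run has at most `n` batches, each with at most `n` pruning
rounds, and a round computes two families of `2n` estimates. The union bound gives failure at most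
`4n³(11/12)^K`, which a logarithmic `K` brings below `n^(-c)`.

What a good batch does. A vertex leaves its bucket for one of three reasons. It entered the batch
`B` and is deleted; it was stale, so at most a fraction `γ` of its ancestors or of its ancestor
edges lies outside those of `B`; or it was pruned, where a measured ratio at most `2γ` means a true
ratio at most `4γ`. So deleting the ancestors of `B` divides, for every vertex, its number of
ancestors or of ancestor edges by `g = 1/(4γ)` or more (`Reduced`). The initial estimates only
choose the buckets, so their accuracy is irrelevant.

Length of the schedule. Freshness bounds the total size of the units of a batch by `1/γ` times the
number of jobs deleted with it (`FreshList.sum_card_le`). Greedy list scheduling exceeds the average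
load by at most one unit (`listSchedule_load`). The deleted sets partition the jobs, so the averages
add up to `|V_H|/(γM)`. What remains is, per batch, `ρ` idle slots plus the largest unit, at most
`3ρ` together.

Number of batches. A vertex starts with at most `2ρ` ancestors and fewer than `(2ρ)²` ancestor
edges, and each batch divides one of the two by `g`. If a vertex survives to the last of `n + 1`
batches, then `g^(n+1) ≤ (2ρ)^4`, giving at most `4 log_g(2ρ)` batches at `3ρ` each. The one
exception, three batches with `(2ρ)^4 < g³` (`ShrinkSeq.length_cases`), is handled by a direct
bound: the later units are so small that the total is at most `6ρ`, and `log_g(2ρ) ≥ 1/2` by the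
lower bound on `γ`. -/

noncomputable section

namespace CommDelay

set_option linter.unusedSectionVars false

/-! ### Moments and collisions of a 2-universal hash family -/

section Hash

variable {α : Type*} {N : ℕ}

/-- A single element is hashed uniformly. -/
lemma HashFamily.card_single [Nontrivial α] (F : HashFamily α N) (x : α) (a : Fin N) :
    (F.funcs.filter fun h => h x = a).card * N = F.funcs.card := by
  obtain ⟨y, hy⟩ := exists_ne x
  have hN : 0 < N := a.pos
  have h1 : (F.funcs.filter fun h => h x = a).card =
      ∑ b : Fin N, (F.funcs.filter fun h => h x = a ∧ h y = b).card := by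
    rw [Finset.card_eq_sum_card_fiberwise (f := fun h => h y) (t := Finset.univ)
      (fun _ _ => Finset.mem_coe.2 (Finset.mem_univ _))]
    simp only [Finset.filter_filter]
  have h2 : (F.funcs.filter fun h => h x = a).card * N ^ 2 = N * F.funcs.card := by
    rw [h1, Finset.sum_mul, Finset.sum_congr rfl fun b _ => F.universal x y hy.symm a b]
    simp
  have h3 : N * ((F.funcs.filter fun h => h x = a).card * N) = N * F.funcs.card := by
    rw [← h2]; ring
  exact Nat.eq_of_mul_eq_mul_left hN h3

lemma card_fin_val_lt {θ : ℕ} (hθ : θ ≤ N) :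
    (Finset.univ.filter fun a : Fin N => (a : ℕ) < θ).card = θ := by
  rw [Fin.card_filter_val_lt]; omega

lemma HashFamily.card_below [Nontrivial α] (F : HashFamily α N) (hN : 0 < N) (x : α) {θ : ℕ}
    (hθ : θ ≤ N) :
    ((F.funcs.filter fun h => (h x : ℕ) < θ).card : ℝ) = F.funcs.card * (θ / N) := by
  have h1 : (F.funcs.filter fun h => (h x : ℕ) < θ).card =
      ∑ a ∈ Finset.univ.filter (fun a : Fin N => (a : ℕ) < θ),
        (F.funcs.filter fun h => h x = a).card := by
    rw [Finset.card_eq_sum_card_fiberwise (f := fun h => h x)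
      (t := Finset.univ.filter (fun a : Fin N => (a : ℕ) < θ)) (by intro h; simp)]
    refine Finset.sum_congr rfl fun a ha => ?_
    congr 1
    ext h
    simp only [Finset.mem_filter, Finset.mem_univ, true_and] at ha ⊢
    constructor
    · rintro ⟨⟨h1, _⟩, h3⟩; exact ⟨h1, h3⟩
    · rintro ⟨h1, rfl⟩; exact ⟨⟨h1, ha⟩, rfl⟩
  have h2 : (F.funcs.filter fun h => (h x : ℕ) < θ).card * N = θ * F.funcs.card := by
    rw [h1, Finset.sum_mul, Finset.sum_congr rfl fun a _ => F.card_single x a]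
    simp [card_fin_val_lt hθ]
  have h3 : ((F.funcs.filter fun h => (h x : ℕ) < θ).card : ℝ) * N = θ * F.funcs.card := by
    exact_mod_cast h2
  field_simp
  linarith

lemma HashFamily.card_below_pair (F : HashFamily α N) (hN : 0 < N) {x y : α} (hxy : x ≠ y)
    {θ : ℕ} (hθ : θ ≤ N) :
    ((F.funcs.filter fun h => (h x : ℕ) < θ ∧ (h y : ℕ) < θ).card : ℝ) =
      F.funcs.card * (θ / N) ^ 2 := by
  set T := Finset.univ.filter (fun a : Fin N => (a : ℕ) < θ) with hT
  have h1 : (F.funcs.filter fun h => (h x : ℕ) < θ ∧ (h y : ℕ) < θ).card =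
      ∑ a ∈ T ×ˢ T, (F.funcs.filter fun h => h x = a.1 ∧ h y = a.2).card := by
    rw [Finset.card_eq_sum_card_fiberwise (f := fun h => (h x, h y)) (t := T ×ˢ T)
      (by intro h; simp [hT])]
    refine Finset.sum_congr rfl fun a ha => ?_
    congr 1
    ext h
    simp only [hT, Finset.mem_filter, Finset.mem_univ, true_and, Finset.mem_product] at ha ⊢
    constructor
    · rintro ⟨⟨h1, _⟩, rfl⟩; exact ⟨h1, rfl, rfl⟩
    · rintro ⟨h1, h2, h3⟩; exact ⟨⟨h1, h2 ▸ ha.1, h3 ▸ ha.2⟩, Prod.ext h2 h3⟩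
  have h2 : (F.funcs.filter fun h => (h x : ℕ) < θ ∧ (h y : ℕ) < θ).card * N ^ 2 =
      θ ^ 2 * F.funcs.card := by
    rw [h1, Finset.sum_mul, Finset.sum_congr rfl fun a _ => F.universal x y hxy a.1 a.2]
    simp [hT, card_fin_val_lt hθ, sq]
  have h3 : ((F.funcs.filter fun h => (h x : ℕ) < θ ∧ (h y : ℕ) < θ).card : ℝ) * (N : ℝ) ^ 2 =
      (θ : ℝ) ^ 2 * F.funcs.card := by
    exact_mod_cast h2
  field_simp
  linarith

/-- A tree stores hash values rather than elements, so its size reflects the cardinality only when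
the hash function does not collide on the set. -/
lemma HashFamily.card_collide (F : HashFamily α N) (hN : 0 < N) {x y : α} (hxy : x ≠ y) :
    ((F.funcs.filter fun h => h x = h y).card : ℝ) = F.funcs.card / N := by
  have h1 : (F.funcs.filter fun h => h x = h y).card =
      ∑ a : Fin N, (F.funcs.filter fun h => h x = a ∧ h y = a).card := by
    rw [Finset.card_eq_sum_card_fiberwise (f := fun h => h x) (t := Finset.univ)
      (fun _ _ => Finset.mem_coe.2 (Finset.mem_univ _))]
    refine Finset.sum_congr rfl fun a _ => ?_
    congr 1
    ext h
    simp only [Finset.mem_filter]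
    constructor
    · rintro ⟨⟨h1, h2⟩, rfl⟩; exact ⟨h1, rfl, h2.symm⟩
    · rintro ⟨h1, h2, h3⟩; exact ⟨⟨h1, h2.trans h3.symm⟩, h2⟩
  have h2 : (F.funcs.filter fun h => h x = h y).card * N ^ 2 = N * F.funcs.card := by
    rw [h1, Finset.sum_mul, Finset.sum_congr rfl fun a _ => F.universal x y hxy a a]
    simp
  have h3 : ((F.funcs.filter fun h => h x = h y).card : ℝ) * (N : ℝ) ^ 2 = N * F.funcs.card := by
    exact_mod_cast h2
  field_simp
  have hN' : (N : ℝ) ≠ 0 := by positivity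
  apply mul_left_cancel₀ hN'
  linarith

/-- The number of elements of `S` whose hash value is among the `θ` smallest ones. -/
def belowCount (S : Finset α) (θ : ℕ) (h : α → Fin N) : ℕ :=
  (S.filter fun x => (h x : ℕ) < θ).card

lemma HashFamily.sum_belowCount [Nontrivial α] (F : HashFamily α N) (hN : 0 < N) (S : Finset α)
    {θ : ℕ} (hθ : θ ≤ N) :
    ∑ h ∈ F.funcs, (belowCount S θ h : ℝ) = F.funcs.card * (S.card * (θ / N)) := by
  have : ∑ h ∈ F.funcs, (belowCount S θ h : ℝ) =
      ∑ x ∈ S, ((F.funcs.filter fun h => (h x : ℕ) < θ).card : ℝ) := by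
    simp only [belowCount, Finset.card_filter, Nat.cast_sum]
    exact Finset.sum_comm
  rw [this, Finset.sum_congr rfl fun x _ => F.card_below hN x hθ]
  simp; ring

/-- Pairwise independence suffices for second moments: off-diagonal pairs contribute `p²` each and
diagonal ones `p`. Hence the variance is at most the mean. -/
lemma HashFamily.sum_belowCount_sq_le [Nontrivial α] (F : HashFamily α N) (hN : 0 < N)
    (S : Finset α) {θ : ℕ} (hθ : θ ≤ N) :
    ∑ h ∈ F.funcs, (belowCount S θ h : ℝ) ^ 2 ≤
      F.funcs.card * ((S.card * (θ / N)) ^ 2 + S.card * (θ / N)) := by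
  classical
  have h1 : ∑ h ∈ F.funcs, (belowCount S θ h : ℝ) ^ 2 =
      ∑ x ∈ S, ∑ y ∈ S,
        ((F.funcs.filter fun h => (h x : ℕ) < θ ∧ (h y : ℕ) < θ).card : ℝ) := by
    have h0 : ∀ h : α → Fin N, (belowCount S θ h : ℝ) ^ 2 =
        ∑ x ∈ S, ∑ y ∈ S, (if (h x : ℕ) < θ ∧ (h y : ℕ) < θ then (1 : ℝ) else 0) := by
      intro h
      simp only [belowCount, Finset.card_filter, Nat.cast_sum, sq, Finset.sum_mul_sum]
      refine Finset.sum_congr rfl fun x _ => Finset.sum_congr rfl fun y _ => ?_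
      by_cases hx : (h x : ℕ) < θ <;> by_cases hy : (h y : ℕ) < θ <;> simp [hx, hy]
    rw [Finset.sum_congr rfl fun h _ => h0 h, Finset.sum_comm]
    refine Finset.sum_congr rfl fun x _ => ?_
    rw [Finset.sum_comm]
    refine Finset.sum_congr rfl fun y _ => ?_
    rw [Finset.sum_boole]
  have hp : (0 : ℝ) ≤ θ / N := by positivity
  have h2 : ∀ x ∈ S, ∀ y ∈ S,
      ((F.funcs.filter fun h => (h x : ℕ) < θ ∧ (h y : ℕ) < θ).card : ℝ) ≤
        F.funcs.card * (θ / N : ℝ) ^ 2 +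
          if x = y then F.funcs.card * (θ / N : ℝ) else 0 := by
    intro x _ y _
    by_cases hxy : x = y
    · subst hxy
      simp only [and_self, if_true]
      rw [F.card_below hN x hθ]
      have : (0 : ℝ) ≤ F.funcs.card * (θ / N : ℝ) ^ 2 := by positivity
      linarith
    · rw [F.card_below_pair hN hxy hθ]; simp [hxy]
  rw [h1]
  refine (Finset.sum_le_sum fun x hx => Finset.sum_le_sum fun y hy => h2 x hx y hy).trans ?_
  apply le_of_eq
  simp only [Finset.sum_add_distrib, Finset.sum_const, nsmul_eq_mul, Finset.sum_ite_eq]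
  rw [Finset.sum_congr rfl (g := fun _ => (F.funcs.card * (θ / N : ℝ)))
    (fun x hx => by simp [hx])]
  simp only [Finset.sum_const, nsmul_eq_mul]
  ring

/-- Chebyshev's inequality for the number of small hash values. -/
lemma HashFamily.chebyshev [Nontrivial α] (F : HashFamily α N) (hN : 0 < N) (S : Finset α)
    {θ : ℕ} (hθ : θ ≤ N) {d : ℝ} (hd : 0 < d) :
    ((F.funcs.filter fun h => d ≤ |(belowCount S θ h : ℝ) - S.card * (θ / N)|).card : ℝ) * d ^ 2 ≤
      F.funcs.card * (S.card * (θ / N)) := by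
  set μ : ℝ := S.card * (θ / N) with hμ
  have h1 : ∑ h ∈ F.funcs, ((belowCount S θ h : ℝ) - μ) ^ 2 ≤ F.funcs.card * μ := by
    have : ∑ h ∈ F.funcs, ((belowCount S θ h : ℝ) - μ) ^ 2 =
        ∑ h ∈ F.funcs, (belowCount S θ h : ℝ) ^ 2 -
          2 * μ * ∑ h ∈ F.funcs, (belowCount S θ h : ℝ) + F.funcs.card * μ ^ 2 := by
      rw [Finset.mul_sum, ← Finset.sum_sub_distrib]
      rw [← nsmul_eq_mul, ← Finset.sum_const, ← Finset.sum_add_distrib]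
      exact Finset.sum_congr rfl fun h _ => by ring
    rw [this, F.sum_belowCount hN S hθ]
    have := F.sum_belowCount_sq_le hN S hθ
    rw [← hμ] at this ⊢
    nlinarith
  refine le_trans ?_ h1
  calc ((F.funcs.filter fun h => d ≤ |(belowCount S θ h : ℝ) - μ|).card : ℝ) * d ^ 2
      = ∑ _h ∈ F.funcs.filter (fun h => d ≤ |(belowCount S θ h : ℝ) - μ|), d ^ 2 := by simp
    _ ≤ ∑ h ∈ F.funcs.filter (fun h => d ≤ |(belowCount S θ h : ℝ) - μ|),
          ((belowCount S θ h : ℝ) - μ) ^ 2 := by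
        refine Finset.sum_le_sum fun h hh => ?_
        rw [← sq_abs ((belowCount S θ h : ℝ) - μ)]
        exact pow_le_pow_left₀ hd.le (Finset.mem_filter.1 hh).2 2
    _ ≤ _ := Finset.sum_le_sum_of_subset_of_nonneg (Finset.filter_subset _ _)
        fun _ _ _ => sq_nonneg _

-- Union bound over ordered pairs; counting each pair twice is affordable.
open Classical in
lemma HashFamily.card_not_injOn_le (F : HashFamily α N) (hN : 0 < N) (S : Finset α) :
    ((F.funcs.filter fun h => ¬ Set.InjOn h S).card : ℝ) ≤
      F.funcs.card * ((S.card * S.card - S.card) / N) := by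
  have hsub : (F.funcs.filter fun h => ¬ Set.InjOn h S) ⊆
      S.offDiag.biUnion fun p => F.funcs.filter fun h => h p.1 = h p.2 := by
    intro h hh
    rw [Finset.mem_filter] at hh
    simp only [Set.InjOn, not_forall] at hh
    obtain ⟨hF, x, hx, y, hy, hxy, hne⟩ := hh
    simp only [Finset.mem_biUnion, Finset.mem_offDiag, Finset.mem_filter]
    exact ⟨(x, y), ⟨hx, hy, hne⟩, hF, hxy⟩
  have h1 : ((F.funcs.filter fun h => ¬ Set.InjOn h S).card : ℝ) ≤
      ∑ p ∈ S.offDiag, ((F.funcs.filter fun h => h p.1 = h p.2).card : ℝ) := by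
    exact_mod_cast (Finset.card_le_card hsub).trans Finset.card_biUnion_le
  refine h1.trans (le_of_eq ?_)
  rw [Finset.sum_congr rfl fun p hp => F.card_collide hN (Finset.mem_offDiag.1 hp).2.2]
  rw [Finset.sum_const, Finset.offDiag_card, nsmul_eq_mul,
    Nat.cast_sub (Nat.le_mul_self _)]
  push_cast
  ring

end Hash

/-! ### Accuracy of the estimate from a single tree -/

section Tree

variable {α : Type*} {N : ℕ}

/-- The hash values of the elements of `S`, read as elements of `{1, …, N}`. -/
def hashValues (h : α → Fin N) (S : Finset α) : Finset ℕ := S.image fun a => (h a : ℕ) + 1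

lemma hashTree_subset (t : ℕ) (h : α → Fin N) (S : Finset α) :
    hashTree t h S ⊆ hashValues h S := by
  intro x hx
  rw [hashTree, List.mem_toFinset] at hx
  exact (Finset.mem_sort _).1 (List.mem_of_mem_take hx)

lemma card_hashTree (t : ℕ) (h : α → Fin N) (S : Finset α) :
    (hashTree t h S).card = min t (hashValues h S).card := by
  rw [hashTree, List.toFinset_card_of_nodup ((Finset.sort_nodup _ _).take), List.length_take,
    Finset.length_sort]
  rfl

/-- The tree is an initial segment of the sorted values, so an omitted value dominates every kept
one. -/
lemma le_of_mem_hashTree {t : ℕ} {h : α → Fin N} {S : Finset α} {x y : ℕ}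
    (hx : x ∈ hashTree t h S) (hy : y ∈ hashValues h S) (hy' : y ∉ hashTree t h S) : x ≤ y := by
  set l := (hashValues h S).sort (· ≤ ·) with hl
  have hs : l.Pairwise (· ≤ ·) := Finset.pairwise_sort _ _
  rw [← List.take_append_drop t l, List.pairwise_append] at hs
  have hx' : x ∈ l.take t := by
    rw [hashTree, List.mem_toFinset] at hx; exact hx
  have hyl : y ∈ l := (Finset.mem_sort _).2 hy
  rw [← List.take_append_drop t l, List.mem_append] at hyl
  rcases hyl with hyl | hyl
  · exact absurd (by rw [hashTree, List.mem_toFinset]; exact hyl) hy'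
  · exact hs.2.2 x hx' y hyl

lemma card_hashValues {h : α → Fin N} {S : Finset α} (hinj : Set.InjOn h S) :
    (hashValues h S).card = S.card := by
  apply Finset.card_image_of_injOn
  intro x hx y hy hxy
  exact hinj hx hy (Fin.ext (by simpa using hxy))

lemma card_hashValues_le {h : α → Fin N} {S : Finset α} (hinj : Set.InjOn h S) (θ : ℕ) :
    ((hashValues h S).filter fun v => v ≤ θ).card = belowCount S θ h := by
  rw [hashValues, Finset.filter_image, belowCount, Finset.card_image_of_injOn]
  · rfl
  · intro x hx y hy hxy
    simp only [Finset.coe_filter, Set.mem_ofPred_eq] at hx hy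
    exact hinj hx.1 hy.1 (Fin.ext (by simpa using hxy))

/-- `e` estimates `s` up to a factor between `2/3` and `4/3`. -/
def GoodEstimate (s : ℕ) (e : ℝ) : Prop := 2 / 3 * (s : ℝ) ≤ e ∧ e ≤ 4 / 3 * (s : ℝ)

lemma treeEstimate_of_card_lt {t : ℕ} {h : α → Fin N} {S : Finset α} (hinj : Set.InjOn h S)
    (hS : S.card < t) : GoodEstimate S.card (treeEstimate t N (hashTree t h S)) := by
  have h1 : (hashTree t h S).card = S.card := by
    rw [card_hashTree, card_hashValues hinj]; omega
  rw [treeEstimate, if_pos (by omega), h1]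
  have : (0 : ℝ) ≤ S.card := by positivity
  constructor <;> linarith

/-- The estimate `tN/ℓ` is within the factors 2/3 and 4/3 once `ℓ` lies between 3/4 and 3/2 of the
ideal value `tN/|S|`. Fewer than `t` values up to `θ₁` force `ℓ > θ₁`; at least `t` values up to
`θ₂` force `ℓ ≤ θ₂`. When `θ₂ ≥ N` the upper bound is automatic. -/
lemma goodEstimate_of_belowCount {t : ℕ} (ht : 0 < t) {h : α → Fin N} {S : Finset α}
    (hinj : Set.InjOn h S) (hS : t ≤ S.card) {θ₁ θ₂ : ℕ}
    (hθ₁ : θ₁ = ⌊3 / 4 * (t * N / S.card : ℝ)⌋₊) (hθ₂ : θ₂ = ⌊3 / 2 * (t * N / S.card : ℝ)⌋₊)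
    (h₁ : belowCount S θ₁ h < t) (h₂ : θ₂ < N → t ≤ belowCount S θ₂ h) :
    GoodEstimate S.card (treeEstimate t N (hashTree t h S)) := by
  have hc : (hashTree t h S).card = t := by
    rw [card_hashTree, card_hashValues hinj]; omega
  have hne : (hashTree t h S).Nonempty := by rw [← Finset.card_pos]; omega
  obtain ⟨l, hlT, hl⟩ := Finset.exists_mem_eq_sup _ hne id
  simp only [id] at hl
  rw [treeEstimate, if_neg (by omega), hl]
  have hs : (0 : ℝ) < S.card := by exact_mod_cast (by omega : 0 < S.card)
  have ht' : (0 : ℝ) < t := by exact_mod_cast ht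
  have hlN : 1 ≤ l ∧ l ≤ N := by
    obtain ⟨a, _, ha⟩ := Finset.mem_image.1 (hashTree_subset _ _ _ hlT)
    have := (h a).2
    omega
  have hl0 : (0 : ℝ) < l := by exact_mod_cast hlN.1
  have hmax : ∀ x ∈ hashTree t h S, x ≤ l := fun x hx => hl ▸ Finset.le_sup (f := id) hx
  have hlow : θ₁ < l := by
    by_contra hcon
    push Not at hcon
    have : (hashTree t h S).card ≤ ((hashValues h S).filter fun v => v ≤ θ₁).card :=
      Finset.card_le_card fun x hx =>
        Finset.mem_filter.2 ⟨hashTree_subset _ _ _ hx, (hmax x hx).trans hcon⟩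
    rw [card_hashValues_le hinj] at this
    omega
  have hupp : l ≤ θ₂ := by
    by_contra hcon
    push Not at hcon
    have h3 := h₂ (by omega)
    -- If `l` exceeded `θ₂`, all values up to `θ₂` would be in the tree and differ from `l`, leaving
    -- room for only `t - 1` of them.
    have hsub : ((hashValues h S).filter fun v => v ≤ θ₂) ⊆ (hashTree t h S).erase l := by
      intro x hx
      rw [Finset.mem_filter] at hx
      refine Finset.mem_erase.2 ⟨by omega, ?_⟩
      by_contra hx'
      have := le_of_mem_hashTree hlT hx.1 hx'
      omega
    have := Finset.card_le_card hsub
    rw [card_hashValues_le hinj, Finset.card_erase_of_mem hlT] at this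
    omega
  have hlow' : 3 / 4 * (t * N / S.card : ℝ) < l := by
    rw [hθ₁] at hlow; exact (Nat.floor_lt (by positivity)).1 hlow
  have hupp' : (l : ℝ) ≤ 3 / 2 * (t * N / S.card : ℝ) := by
    rw [hθ₂] at hupp; exact (Nat.le_floor_iff (by positivity)).1 hupp
  have e1 : (t * N / S.card : ℝ) * S.card = t * N := by field_simp
  constructor
  · rw [le_div_iff₀ hl0]; nlinarith
  · rw [div_le_iff₀ hl0]; nlinarith

/-- Chebyshev with variance at most `3t/2` and deviation `t/4` gives `24/t`, hence the choice of
1000 as the least tree size. -/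
lemma HashFamily.card_tail_le [Nontrivial α] (F : HashFamily α N) (hN : 0 < N) (S : Finset α)
    {θ t : ℕ} (ht : 1000 ≤ t) (hθ : θ ≤ N) (hμ : (S.card * (θ / N) : ℝ) ≤ 3 / 2 * t) :
    ((F.funcs.filter fun h =>
      (t : ℝ) / 4 ≤ |(belowCount S θ h : ℝ) - S.card * (θ / N)|).card : ℝ) ≤
      F.funcs.card * (24 / 1000) := by
  have ht' : (1000 : ℝ) ≤ t := by exact_mod_cast ht
  have h1 := F.chebyshev hN S hθ (d := t / 4) (by linarith)
  set b := (F.funcs.filter fun h =>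
    (t : ℝ) / 4 ≤ |(belowCount S θ h : ℝ) - S.card * (θ / N)|).card
  have h2 : (b : ℝ) * (t / 4) ^ 2 ≤ F.funcs.card * (3 / 2 * t) :=
    h1.trans (mul_le_mul_of_nonneg_left hμ (by positivity))
  have h3 : (b : ℝ) * t ≤ F.funcs.card * 24 := by
    have : t * ((b : ℝ) * t) ≤ t * (F.funcs.card * 24) := by nlinarith
    exact le_of_mul_le_mul_left this (by linarith)
  have : (b : ℝ) * 1000 ≤ b * t := mul_le_mul_of_nonneg_left ht' (by positivity)
  linarith

open Classical in
/-- A single hash function gives a good estimate with probability at least `7/10`. -/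
lemma HashFamily.card_bad_le [Nontrivial α] {U : ℕ} (F : HashFamily α N) (hNU : N = U ^ 3)
    (hU : 2 ≤ U) {t : ℕ} (ht : 1000 ≤ t) (S : Finset α) (hS : S.card ≤ U) :
    ((F.funcs.filter fun h =>
      ¬ GoodEstimate S.card (treeEstimate t N (hashTree t h S))).card : ℝ) ≤
      F.funcs.card * (3 / 10) := by
  have hN : 0 < N := by rw [hNU]; positivity
  have hU' : (2 : ℝ) ≤ U := by exact_mod_cast hU
  have hSU : (S.card : ℝ) ≤ U := by exact_mod_cast hS
  have hS0 : (0 : ℝ) ≤ S.card := by positivity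
  have hF0 : (0 : ℝ) ≤ F.funcs.card := by positivity
  -- With `|S| ≤ U` the collision probability is at most `(U - 1)/U²`, whose maximum is 1/4, at `U =
  -- 2`.
  have hcoll : ((F.funcs.filter fun h => ¬ Set.InjOn h S).card : ℝ) ≤
      F.funcs.card * (1 / 4) := by
    refine (F.card_not_injOn_le hN S).trans (mul_le_mul_of_nonneg_left ?_ hF0)
    rw [hNU]
    push_cast
    rw [div_le_iff₀ (by positivity)]
    rcases Nat.eq_zero_or_pos S.card with h0 | h0
    · rw [h0]; push_cast; nlinarith [pow_pos (show (0 : ℝ) < U by linarith) 3]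
    · have h1 : (1 : ℝ) ≤ S.card := by exact_mod_cast h0
      nlinarith [mul_nonneg (show (0 : ℝ) ≤ U by linarith) (sq_nonneg ((U : ℝ) - 2)),
        mul_nonneg (sub_nonneg.2 hSU) (show (0 : ℝ) ≤ U + S.card - 1 by linarith)]
  by_cases hSt : S.card < t
  · refine le_trans ?_ (hcoll.trans (by nlinarith))
    have : (F.funcs.filter fun h =>
        ¬ GoodEstimate S.card (treeEstimate t N (hashTree t h S))) ⊆
        F.funcs.filter fun h => ¬ Set.InjOn h S := by
      intro h hh
      rw [Finset.mem_filter] at hh ⊢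
      exact ⟨hh.1, fun hinj => hh.2 (treeEstimate_of_card_lt hinj hSt)⟩
    exact_mod_cast Finset.card_le_card this
  push Not at hSt
  have ht' : (1000 : ℝ) ≤ t := by exact_mod_cast ht
  have hSt' : (t : ℝ) ≤ S.card := by exact_mod_cast hSt
  have hs : (0 : ℝ) < S.card := by linarith
  have hN' : (0 : ℝ) < N := by exact_mod_cast hN
  set θ₁ := ⌊3 / 4 * (t * N / S.card : ℝ)⌋₊ with hθ₁
  set θ₂ := ⌊3 / 2 * (t * N / S.card : ℝ)⌋₊ with hθ₂
  have e1 : (t * N / S.card : ℝ) * S.card = t * N := by field_simp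
  have hSN : (S.card : ℝ) ≤ N := by
    have : S.card ≤ N := hNU ▸ hS.trans (Nat.le_self_pow (by norm_num) U)
    exact_mod_cast this
  have hq : (0 : ℝ) ≤ t * N / S.card := by positivity
  have f1 : (θ₁ : ℝ) ≤ 3 / 4 * (t * N / S.card : ℝ) := Nat.floor_le (by positivity)
  have f2 : (θ₂ : ℝ) ≤ 3 / 2 * (t * N / S.card : ℝ) := Nat.floor_le (by positivity)
  have f3 : 3 / 2 * (t * N / S.card : ℝ) < θ₂ + 1 := Nat.lt_floor_add_one _
  have hqN : (t * N / S.card : ℝ) ≤ N := by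
    rw [div_le_iff₀ hs]; nlinarith
  have hθ₁N : θ₁ ≤ N := by
    have : (θ₁ : ℝ) ≤ N := by linarith
    exact_mod_cast this
  have mu1 : (S.card * (θ₁ / N) : ℝ) ≤ 3 / 4 * t := by
    rw [← mul_div_assoc, div_le_iff₀ hN']; nlinarith
  have mu2 : (S.card * (θ₂ / N) : ℝ) ≤ 3 / 2 * t := by
    rw [← mul_div_assoc, div_le_iff₀ hN']; nlinarith
  -- Rounding `θ₂` down lowers the mean `3t/2` by at most `|S|/N ≤ 1`, well within the slack `t/4`.
  have mu3 : 5 / 4 * (t : ℝ) ≤ (S.card * (θ₂ / N) : ℝ) := by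
    rw [← mul_div_assoc, le_div_iff₀ hN']; nlinarith
  have hA := F.card_tail_le hN S ht hθ₁N (by linarith)
  set A := F.funcs.filter fun h => (t : ℝ) / 4 ≤ |(belowCount S θ₁ h : ℝ) - S.card * (θ₁ / N)|
  obtain ⟨B, hBc, hB⟩ : ∃ B : Finset (α → Fin N), (B.card : ℝ) ≤ F.funcs.card * (24 / 1000) ∧
      (θ₂ < N → B = F.funcs.filter fun h =>
        (t : ℝ) / 4 ≤ |(belowCount S θ₂ h : ℝ) - S.card * (θ₂ / N)|) := by
    by_cases hθN : θ₂ < N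
    · exact ⟨_, F.card_tail_le hN S ht hθN.le mu2, fun _ => rfl⟩
    · exact ⟨∅, by rw [Finset.card_empty, Nat.cast_zero]; positivity, fun h => absurd h hθN⟩
  -- The three causes of failure have total probability at most `1/4 + 24/1000 + 24/1000 < 3/10`.
  have hsub : (F.funcs.filter fun h =>
      ¬ GoodEstimate S.card (treeEstimate t N (hashTree t h S))) ⊆
      (F.funcs.filter fun h => ¬ Set.InjOn h S) ∪ (A ∪ B) := by
    intro h hh
    rw [Finset.mem_filter] at hh
    by_contra hcon
    simp only [Finset.mem_union, not_or] at hcon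
    obtain ⟨c1, c2, c3⟩ := hcon
    have hinj : Set.InjOn h S := by
      by_contra hc; exact c1 (Finset.mem_filter.2 ⟨hh.1, hc⟩)
    refine hh.2 (goodEstimate_of_belowCount (by omega) hinj hSt hθ₁ hθ₂ ?_ ?_)
    · by_contra hc
      push Not at hc
      have hc' : (t : ℝ) ≤ belowCount S θ₁ h := by exact_mod_cast hc
      exact c2 (Finset.mem_filter.2 ⟨hh.1, le_trans (by linarith) (le_abs_self _)⟩)
    · intro hθN
      by_contra hc
      push Not at hc
      have hc' : (belowCount S θ₂ h : ℝ) ≤ t := by exact_mod_cast hc.le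
      rw [hB hθN] at c3
      exact c3 (Finset.mem_filter.2 ⟨hh.1, le_trans (by linarith) (neg_le_abs _)⟩)
  have h1 : ((F.funcs.filter fun h =>
      ¬ GoodEstimate S.card (treeEstimate t N (hashTree t h S))).card : ℝ) ≤
      (F.funcs.filter fun h => ¬ Set.InjOn h S).card + (A.card + B.card) := by
    exact_mod_cast (Finset.card_le_card hsub).trans ((Finset.card_union_le _ _).trans
      (Nat.add_le_add_left (Finset.card_union_le _ _) _))
  linarith

end Tree

/-! ### The median of the trees -/

section Median

/-- If fewer than half of the entries violate a two-sided bound, then the median satisfies it. -/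
lemma median_mem_of_countP {lo hi : ℝ} {l : List ℝ}
    (h : 2 * l.countP (fun x => decide (¬ (lo ≤ x ∧ x ≤ hi))) < l.length) :
    lo ≤ median l ∧ median l ≤ hi := by
  set s := l.mergeSort fun a b => decide (a ≤ b) with hs
  have hperm : s.Perm l := List.mergeSort_perm _ _
  have hpw : s.Pairwise (· ≤ ·) := by
    have := List.pairwise_mergeSort (le := fun a b : ℝ => decide (a ≤ b))
      (fun a b c h1 h2 => by simp only [decide_eq_true_eq] at *; exact h1.trans h2)
      (fun a b => by simpa using le_total a b) l
    exact this.imp (by simp)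
  have hlen : s.length = l.length := hperm.length_eq
  rw [← hperm.countP_eq] at h
  set p : ℝ → Bool := fun x => decide (¬ (lo ≤ x ∧ x ≤ hi)) with hp
  set k := l.length / 2 with hk
  have hks : k < s.length := by omega
  have hm : median l = s[k] := by
    rw [median, ← hs, ← hk, List.getD_eq_getElem _ _ hks]
  have hsplit : s.countP p = (s.take (k + 1)).countP p + (s.drop (k + 1)).countP p := by
    rw [← List.countP_append, List.take_append_drop]
  have hsplit' : s.countP p = (s.take k).countP p + (s.drop k).countP p := by
    rw [← List.countP_append, List.take_append_drop]
  rw [hm]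
  constructor
  · by_contra hc
    push Not at hc
    -- In sorted order a median below `lo` makes the first `k + 1` entries bad. Symmetrically, a
    -- median above `hi` makes the entries from index `k` on bad. Either way at least half are bad.
    have : (s.take (k + 1)).countP p = (s.take (k + 1)).length := by
      rw [List.countP_eq_length]
      intro a ha
      obtain ⟨i, hi, rfl⟩ := List.mem_take_iff_getElem.1 ha
      have : s[i] ≤ s[k] := by
        rcases Nat.lt_or_ge i k with h' | h'
        · exact List.pairwise_iff_getElem.1 hpw _ _ _ _ h'
        · have : i = k := by omega
          simp [this]
      simp only [hp, decide_eq_true_eq]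
      intro hcon
      linarith [hcon.1]
    rw [List.length_take] at this
    omega
  · by_contra hc
    push Not at hc
    have : (s.drop k).countP p = (s.drop k).length := by
      rw [List.countP_eq_length]
      intro a ha
      obtain ⟨i, hi, rfl⟩ := List.mem_drop_iff_getElem.1 ha
      have : s[k] ≤ s[k + i] := by
        rcases Nat.eq_zero_or_pos i with h' | h'
        · simp [h']
        · exact List.pairwise_iff_getElem.1 hpw _ _ _ _ (by omega)
      simp only [hp, decide_eq_true_eq]
      intro hcon
      have := hcon.2
      linarith
    rw [List.length_drop] at this
    omega

lemma median_ofFn_mem {lo hi : ℝ} {K : ℕ} (f : Fin K → ℝ)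
    (h : 2 * (Finset.univ.filter fun j => ¬ (lo ≤ f j ∧ f j ≤ hi)).card < K) :
    lo ≤ median (List.ofFn f) ∧ median (List.ofFn f) ≤ hi := by
  apply median_mem_of_countP
  rw [List.length_ofFn]
  convert h using 2
  rw [List.ofFn_eq_map, List.countP_map, List.countP_eq_length_filter]
  rfl

end Median

/-! ### Exponential decay of the error by independent repetition -/

section Amplification

open Classical in
/-- Among `K` independent samples, each bad with probability at most `3/10`, half are bad with
probability at most `(11/12) ^ K`. -/
lemma card_half_bad_le {β : Type*} (F : Finset β) (bad : β → Prop)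
    (hbad : ((F.filter bad).card : ℝ) ≤ F.card * (3 / 10)) (K : ℕ) :
    ((((Fintype.piFinset fun _ : Fin K => F).filter fun x =>
      K ≤ 2 * (Finset.univ.filter fun j => bad (x j)).card).card : ℕ) : ℝ) ≤
      (F.card : ℝ) ^ K * (11 / 12) ^ K := by
  -- Markov's inequality for a product of independent weights. As `(3/2)(2/3) = 1`, the product is
  -- at least 1 when half the samples are bad, while the mean weight is at most `(3/10)(3/2) +
  -- (7/10)(2/3) = 11/12`.
  set w : β → ℝ := fun h => if bad h then 3 / 2 else 2 / 3 with hw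
  have hw0 : ∀ h, 0 ≤ w h := fun h => by simp only [hw]; split_ifs <;> norm_num
  have hsum : ∑ h ∈ F, w h ≤ F.card * (11 / 12) := by
    have h1 : ∑ h ∈ F, w h = (F.filter bad).card * (3 / 2) +
        (F.filter fun h => ¬ bad h).card * (2 / 3) := by
      simp only [hw]
      rw [Finset.sum_ite]
      simp
    have h2 : ((F.filter bad).card : ℝ) + (F.filter fun h => ¬ bad h).card = F.card := by
      exact_mod_cast Finset.card_filter_add_card_filter_not (s := F) bad
    rw [h1]; linarith
  have hprod : ∑ x ∈ Fintype.piFinset fun _ : Fin K => F, ∏ j, w (x j) = (∑ h ∈ F, w h) ^ K := by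
    rw [← Finset.prod_univ_sum]; simp
  have h1 : ∀ x ∈ (Fintype.piFinset fun _ : Fin K => F).filter
      (fun x => K ≤ 2 * (Finset.univ.filter fun j => bad (x j)).card),
      (1 : ℝ) ≤ ∏ j, w (x j) := by
    intro x hx
    have hx2 := (Finset.mem_filter.1 hx).2
    have h3 := Finset.card_filter_add_card_filter_not (s := (Finset.univ : Finset (Fin K)))
      fun j => bad (x j)
    rw [Finset.card_univ, Fintype.card_fin] at h3
    simp only [hw]
    rw [Finset.prod_ite, Finset.prod_const, Finset.prod_const]
    set b := (Finset.univ.filter fun j => bad (x j)).card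
    set g := (Finset.univ.filter fun j => ¬ bad (x j)).card
    obtain ⟨d, hd⟩ : ∃ d, b = g + d := ⟨b - g, by omega⟩
    rw [hd, pow_add, mul_right_comm, ← mul_pow]
    norm_num
    exact one_le_pow₀ (by norm_num)
  calc ((((Fintype.piFinset fun _ : Fin K => F).filter fun x =>
      K ≤ 2 * (Finset.univ.filter fun j => bad (x j)).card).card : ℕ) : ℝ)
      = ∑ x ∈ (Fintype.piFinset fun _ : Fin K => F).filter
          (fun x => K ≤ 2 * (Finset.univ.filter fun j => bad (x j)).card), (1 : ℝ) := by simp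
    _ ≤ ∑ x ∈ (Fintype.piFinset fun _ : Fin K => F).filter
          (fun x => K ≤ 2 * (Finset.univ.filter fun j => bad (x j)).card), ∏ j, w (x j) :=
        Finset.sum_le_sum h1
    _ ≤ ∑ x ∈ Fintype.piFinset fun _ : Fin K => F, ∏ j, w (x j) :=
        Finset.sum_le_sum_of_subset_of_nonneg (Finset.filter_subset _ _)
          fun x _ _ => Finset.prod_nonneg fun j _ => hw0 _
    _ = (∑ h ∈ F, w h) ^ K := hprod
    _ ≤ (F.card * (11 / 12)) ^ K := pow_le_pow_left₀ (Finset.sum_nonneg fun h _ => hw0 h) hsum K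
    _ = _ := mul_pow _ _ _

end Amplification

/-! ### Calculus of failure probabilities -/

section FailProb

open scoped ENNReal

variable {α β : Type*}

/-- The probability that a sample from `p` violates `Q`. -/
def failProb (p : PMF α) (Q : α → Prop) : ℝ≥0∞ := p.toOuterMeasure {a | ¬ Q a}

lemma failProb_le_one (p : PMF α) (Q : α → Prop) : failProb p Q ≤ 1 := by
  rw [failProb, PMF.toOuterMeasure_apply, ← p.tsum_coe]
  exact ENNReal.tsum_le_tsum fun a => Set.indicator_le_self _ _ _

lemma failProb_eq_zero {p : PMF α} {Q : α → Prop} (h : ∀ a ∈ p.support, Q a) :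
    failProb p Q = 0 := by
  rw [failProb, PMF.toOuterMeasure_apply_eq_zero_iff, Set.disjoint_left]
  exact fun a ha hQ => hQ (h a ha)

lemma failProb_mono {p : PMF α} {Q Q' : α → Prop} (h : ∀ a ∈ p.support, Q a → Q' a) :
    failProb p Q' ≤ failProb p Q :=
  PMF.toOuterMeasure_mono _ fun _ ⟨ha, ha'⟩ hQ => ha (h _ ha' hQ)

/-- Union bound for two consecutive random steps. -/
lemma failProb_bind_le {p : PMF α} {f : α → PMF β} {G : α → Prop} {Q : β → Prop} {δ₁ δ₂ : ℝ≥0∞}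
    (h₁ : failProb p G ≤ δ₁) (h₂ : ∀ a ∈ p.support, G a → failProb (f a) Q ≤ δ₂) :
    failProb (p.bind f) Q ≤ δ₁ + δ₂ := by
  have hstep : ∀ a, p a * failProb (f a) Q ≤ Set.indicator {a | ¬ G a} p a + p a * δ₂ := by
    intro a
    by_cases ha : p a = 0
    · simp [ha]
    by_cases hG : G a
    · exact (mul_le_mul_right (h₂ a ((PMF.mem_support_iff _ _).2 ha) hG) _).trans le_add_self
    · have : Set.indicator {a | ¬ G a} p a = p a := Set.indicator_of_mem (by exact hG) _
      rw [this]
      exact (mul_le_of_le_one_right' (failProb_le_one _ _)).trans le_self_add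
  calc failProb (p.bind f) Q = ∑' a, p a * failProb (f a) Q :=
        PMF.toOuterMeasure_bind_apply _ _ _
    _ ≤ ∑' a, (Set.indicator {a | ¬ G a} p a + p a * δ₂) := ENNReal.tsum_le_tsum hstep
    _ = failProb p G + δ₂ := by
        rw [ENNReal.tsum_add, ENNReal.tsum_mul_right, p.tsum_coe, one_mul, failProb,
          PMF.toOuterMeasure_apply]
    _ ≤ δ₁ + δ₂ := add_le_add_left h₁ _

lemma failProb_bind_le_right {p : PMF α} {f : α → PMF β} {Q : β → Prop} {δ : ℝ≥0∞}
    (h : ∀ a ∈ p.support, failProb (f a) Q ≤ δ) : failProb (p.bind f) Q ≤ δ := by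
  have := failProb_bind_le (p := p) (f := f) (G := fun _ => True) (Q := Q) (δ₁ := 0) (δ₂ := δ)
    (failProb_eq_zero fun _ _ => trivial).le fun a ha _ => h a ha
  simpa using this

lemma failProb_forall_le {ι : Type*} [Fintype ι] {p : PMF α} {Q : ι → α → Prop} {δ : ℝ≥0∞}
    (h : ∀ i, failProb p (Q i) ≤ δ) : failProb p (fun a => ∀ i, Q i a) ≤ Fintype.card ι * δ := by
  have : {a | ¬ ∀ i, Q i a} = ⋃ i, {a | ¬ Q i a} := by ext; simp
  rw [failProb, this]
  refine (MeasureTheory.measure_iUnion_le _).trans ?_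
  rw [tsum_fintype]
  refine (Finset.sum_le_sum fun i _ => h i).trans ?_
  simp

end FailProb

/-! ### Simultaneous accuracy of all estimates -/

section Estimates

open scoped ENNReal

lemma failProb_countEstimate_le {α : Type*} [Nontrivial α] {N U : ℕ} (F : HashFamily α N)
    (hNU : N = U ^ 3) (hU : 2 ≤ U) {t : ℕ} (ht : 1000 ≤ t) (K : ℕ) (S : Finset α)
    (hS : S.card ≤ U) :
    failProb (drawHashes F K) (fun hs => GoodEstimate S.card (countEstimate t hs S)) ≤
      ENNReal.ofReal ((11 / 12) ^ K) := by
  classical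
  set bad : (α → Fin N) → Prop := fun h =>
    ¬ GoodEstimate S.card (treeEstimate t N (hashTree t h S)) with hbad
  have h1 := card_half_bad_le F.funcs bad (by convert F.card_bad_le hNU hU ht S hS) K
  set Ω := Fintype.piFinset fun _ : Fin K => F.funcs with hΩ
  have hF : (0 : ℝ) < F.funcs.card := by exact_mod_cast F.nonempty.card_pos
  have hcard : (Ω.card : ℝ) = (F.funcs.card : ℝ) ^ K := by
    rw [hΩ, Fintype.card_piFinset]; simp
  rw [failProb, drawHashes, PMF.toOuterMeasure_uniformOfFinset_apply]
  have h2 : ((Ω.filter fun hs => hs ∈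
      {hs | ¬ GoodEstimate S.card (countEstimate t hs S)}).card : ℝ) ≤
      Ω.card * (11 / 12) ^ K := by
    rw [hcard]
    refine le_trans ?_ h1
    refine Nat.cast_le.2 (Finset.card_le_card fun hs hhs => ?_)
    rw [Finset.mem_filter] at hhs ⊢
    refine ⟨hhs.1, ?_⟩
    by_contra hcon
    push Not at hcon
    refine hhs.2 (median_ofFn_mem _ (lt_of_eq_of_lt ?_ hcon))
    congr 2
    ext j
    simp [hbad, GoodEstimate]
  have hΩ0 : (0 : ℝ) < Ω.card := by rw [hcard]; positivity
  rw [← ENNReal.ofReal_natCast, ← ENNReal.ofReal_natCast, ← ENNReal.ofReal_div_of_pos hΩ0]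
  refine ENNReal.ofReal_le_ofReal ?_
  rw [div_le_iff₀ hΩ0, mul_comm]
  refine le_trans (le_of_eq ?_) h2
  congr!

variable {V : Type*} [Fintype V] [DecidableEq V]

/-- All estimates of the numbers of ancestors and ancestor edges are good. -/
def GoodEstimates (H : FinDigraph V) (e : (V → ℝ) × (V → ℝ)) : Prop :=
  ∀ v, GoodEstimate (H.anc v).card (e.1 v) ∧ GoodEstimate (H.ancEdges v).card (e.2 v)

/-- The same hash functions serve all vertices, so the estimates are dependent; a union bound over
the `n` vertex estimates and the `n` edge estimates needs no independence. -/
lemma failProb_obtainEstimates_le (hV : 2 ≤ Fintype.card V) (P : EstimatorParams V)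
    (ht : 1000 ≤ P.treeSize) (H : FinDigraph V) :
    failProb (obtainEstimates P H) (GoodEstimates H) ≤
      2 * Fintype.card V * ENNReal.ofReal ((11 / 12) ^ P.numHashes) := by
  have : Nontrivial V := Fintype.one_lt_card_iff_nontrivial.1 hV
  set d := ENNReal.ofReal ((11 / 12) ^ P.numHashes)
  have hv : failProb (drawHashes P.vertHash P.numHashes)
      (fun hs => ∀ v, GoodEstimate (H.anc v).card (countEstimate P.treeSize hs (H.anc v))) ≤
      Fintype.card V * d :=
    failProb_forall_le fun v => failProb_countEstimate_le _ rfl hV ht _ _ (Finset.card_le_univ _)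
  have he : failProb (drawHashes P.edgeHash P.numHashes)
      (fun hs => ∀ v, GoodEstimate (H.ancEdges v).card
        (countEstimate P.treeSize hs (H.ancEdges v))) ≤ Fintype.card V * d := by
    refine failProb_forall_le fun v => failProb_countEstimate_le _ rfl (by nlinarith) ht _ _ ?_
    refine (Finset.card_le_univ _).trans (le_of_eq ?_)
    rw [Fintype.card_prod, sq]
  rw [mul_assoc, two_mul]
  refine failProb_bind_le hv fun hs _ h1 => ?_
  rw [← add_zero (_ * d)]
  refine failProb_bind_le he fun hs' _ h2 => le_of_eq (failProb_eq_zero ?_)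
  intro e hmem
  rw [PMF.mem_support_pure_iff] at hmem
  subst hmem
  exact fun v => ⟨h1 v, h2 v⟩

end Estimates

/-! ### Ancestors, subgraphs and topological order -/

namespace FinDigraph

variable {V : Type*} [DecidableEq V]

lemma mem_anc {H : FinDigraph V} {u v : V} :
    u ∈ H.anc v ↔ u ∈ H.verts ∧ Relation.ReflTransGen H.Adj u v := by
  simp [anc]

lemma Adj.left_mem {H : FinDigraph V} {u v : V} (h : H.Adj u v) : u ∈ H.verts :=
  (H.edges_sub _ h).1

lemma Adj.right_mem {H : FinDigraph V} {u v : V} (h : H.Adj u v) : v ∈ H.verts :=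
  (H.edges_sub _ h).2

lemma mem_verts_of_mem_anc {H : FinDigraph V} {u v : V} (h : u ∈ H.anc v) : v ∈ H.verts := by
  obtain ⟨hu, huv⟩ := mem_anc.1 h
  rcases Relation.ReflTransGen.cases_tail huv with rfl | ⟨w, _, hw⟩
  · exact hu
  · exact hw.right_mem

lemma self_mem_anc {H : FinDigraph V} {v : V} (h : v ∈ H.verts) : v ∈ H.anc v :=
  mem_anc.2 ⟨h, .refl⟩

lemma anc_subset_verts (H : FinDigraph V) (v : V) : H.anc v ⊆ H.verts :=
  fun _ hu => (mem_anc.1 hu).1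

lemma Adj.mem_anc_of_mem {H : FinDigraph V} {u w v : V} (h : H.Adj u w) (hw : w ∈ H.anc v) :
    u ∈ H.anc v :=
  mem_anc.2 ⟨h.left_mem, .head h (mem_anc.1 hw).2⟩

lemma mem_ancSet {H : FinDigraph V} {S : Finset V} {u : V} :
    u ∈ H.ancSet S ↔ ∃ v ∈ S, u ∈ H.anc v := by
  simp [ancSet]

lemma ancSet_mono (H : FinDigraph V) {S T : Finset V} (h : S ⊆ T) : H.ancSet S ⊆ H.ancSet T :=
  Finset.biUnion_subset_biUnion_of_subset_left _ h

lemma ancSet_subset_verts (H : FinDigraph V) (S : Finset V) : H.ancSet S ⊆ H.verts :=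
  Finset.biUnion_subset.2 fun v _ => H.anc_subset_verts v

lemma ancSet_insert (H : FinDigraph V) (S : Finset V) (v : V) :
    H.ancSet (insert v S) = H.anc v ∪ H.ancSet S := Finset.biUnion_insert

/-- `G` is a subgraph of `H`. -/
def IsSubgraph (G H : FinDigraph V) : Prop := G.verts ⊆ H.verts ∧ G.edges ⊆ H.edges

lemma IsSubgraph.adj {G H : FinDigraph V} (h : G.IsSubgraph H) {u v : V} (huv : G.Adj u v) :
    H.Adj u v := h.2 huv

lemma IsSubgraph.anc_subset {G H : FinDigraph V} (h : G.IsSubgraph H) (v : V) :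
    G.anc v ⊆ H.anc v := by
  intro u hu
  obtain ⟨hu, huv⟩ := mem_anc.1 hu
  exact mem_anc.2 ⟨h.1 hu, huv.lift id fun _ _ => h.adj⟩

lemma mem_inducedEdges {H : FinDigraph V} {S : Finset V} {e : V × V} :
    e ∈ H.inducedEdges S ↔ e ∈ H.edges ∧ e.1 ∈ S ∧ e.2 ∈ S := by
  simp [inducedEdges]

lemma mem_ancEdges {H : FinDigraph V} {v : V} {e : V × V} :
    e ∈ H.ancEdges v ↔ e ∈ H.edges ∧ e.1 ∈ H.anc v ∧ e.2 ∈ H.anc v := mem_inducedEdges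

lemma IsSubgraph.ancEdges_subset {G H : FinDigraph V} (h : G.IsSubgraph H) (v : V) :
    G.ancEdges v ⊆ H.ancEdges v := by
  intro e he
  rw [mem_ancEdges] at he ⊢
  exact ⟨h.2 he.1, h.anc_subset v he.2.1, h.anc_subset v he.2.2⟩

lemma IsSubgraph.acyclic {G H : FinDigraph V} (h : G.IsSubgraph H) (hH : H.Acyclic) :
    G.Acyclic := fun v hv => hH v (hv.lift id fun _ _ => h.adj)

lemma IsSubgraph.isSmall {G H : FinDigraph V} (h : G.IsSubgraph H) {ρ : ℕ} (hH : H.IsSmall ρ) :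
    G.IsSmall ρ := fun v hv => (Finset.card_le_card (h.anc_subset v)).trans (hH v (h.1 hv))

lemma delete_anti (H : FinDigraph V) {S T : Finset V} (h : S ⊆ T) :
    (H.delete T).IsSubgraph (H.delete S) := by
  constructor
  · exact Finset.sdiff_subset_sdiff le_rfl h
  · intro e he
    simp only [delete, Finset.mem_filter] at he ⊢
    exact ⟨he.1, fun h1 => he.2.1 (h h1), fun h1 => he.2.2 (h h1)⟩

lemma delete_isSubgraph (H : FinDigraph V) (S : Finset V) : (H.delete S).IsSubgraph H :=
  ⟨Finset.sdiff_subset, Finset.filter_subset _ _⟩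

lemma mem_verts_delete {H : FinDigraph V} {S : Finset V} {v : V} :
    v ∈ (H.delete S).verts ↔ v ∈ H.verts ∧ v ∉ S := Finset.mem_sdiff

lemma delete_adj {H : FinDigraph V} {S : Finset V} {u v : V} :
    (H.delete S).Adj u v ↔ H.Adj u v ∧ u ∉ S ∧ v ∉ S := by
  simp [delete, Adj]

lemma anc_delete_subset (H : FinDigraph V) (S : Finset V) (v : V) :
    (H.delete S).anc v ⊆ H.anc v \ S := fun _ hu =>
  Finset.mem_sdiff.2 ⟨(H.delete_isSubgraph S).anc_subset v hu,
    (mem_verts_delete.1 (anc_subset_verts _ _ hu)).2⟩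

lemma ancEdges_delete_subset (H : FinDigraph V) (S : Finset V) (v : V) :
    (H.delete (H.ancSet S)).ancEdges v ⊆ H.ancEdges v \ H.ancEdgesSet S := by
  intro e he
  refine Finset.mem_sdiff.2 ⟨(H.delete_isSubgraph _).ancEdges_subset v he, fun h => ?_⟩
  have h1 := (mem_inducedEdges.1 h).2.1
  have h2 := anc_subset_verts _ _ (mem_ancEdges.1 he).2.1
  exact (mem_verts_delete.1 h2).2 h1

lemma anc_eq_empty {H : FinDigraph V} {v : V} (h : v ∉ H.verts) : H.anc v = ∅ :=
  Finset.eq_empty_of_forall_notMem fun _ hu => h (mem_verts_of_mem_anc hu)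

/-- Every ancestor other than `v` is the source of an edge on a path to `v`. Thus a vertex with few
ancestor edges also has few ancestors. -/
lemma card_anc_le (H : FinDigraph V) (v : V) : (H.anc v).card ≤ (H.ancEdges v).card + 1 := by
  have hsub : H.anc v ⊆ insert v ((H.ancEdges v).image Prod.fst) := by
    intro u hu
    rw [Finset.mem_insert, Finset.mem_image]
    obtain ⟨hu', huv⟩ := mem_anc.1 hu
    rcases Relation.ReflTransGen.cases_head huv with rfl | ⟨w, hw, hwv⟩
    · exact .inl rfl
    · exact .inr ⟨(u, w), mem_ancEdges.2 ⟨hw, hu, mem_anc.2 ⟨hw.right_mem, hwv⟩⟩, rfl⟩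
  exact (Finset.card_le_card hsub).trans ((Finset.card_insert_le _ _).trans
    (Nat.add_le_add_right Finset.card_image_le 1))

/-- By acyclicity an edge and its reverse are distinct off-diagonal pairs of ancestors and are not
both edges, so there are at most `a(a - 1)/2` edges. -/
lemma two_mul_card_ancEdges_le {H : FinDigraph V} (hH : H.Acyclic) (v : V) :
    2 * (H.ancEdges v).card + (H.anc v).card ≤ (H.anc v).card * (H.anc v).card := by
  have hsub : H.ancEdges v ∪ (H.ancEdges v).image Prod.swap ⊆ (H.anc v).offDiag := by
    intro e he
    have key : ∀ e ∈ H.ancEdges v, e.1 ≠ e.2 := fun e he heq => by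
      have : H.Adj e.1 e.2 := (mem_ancEdges.1 he).1
      rw [← heq] at this
      exact hH _ (.single this)
    rw [Finset.mem_offDiag]
    rcases Finset.mem_union.1 he with he | he
    · exact ⟨(mem_ancEdges.1 he).2.1, (mem_ancEdges.1 he).2.2, key e he⟩
    · obtain ⟨f, hf, rfl⟩ := Finset.mem_image.1 he
      exact ⟨(mem_ancEdges.1 hf).2.2, (mem_ancEdges.1 hf).2.1, (key f hf).symm⟩
  have hdisj : Disjoint (H.ancEdges v) ((H.ancEdges v).image Prod.swap) := by
    rw [Finset.disjoint_left]
    intro e he he'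
    obtain ⟨f, hf, rfl⟩ := Finset.mem_image.1 he'
    have h1 : H.Adj f.1 f.2 := (mem_ancEdges.1 hf).1
    have h2 : H.Adj f.2 f.1 := (mem_ancEdges.1 he).1
    exact hH _ (.head h1 (.single h2))
  have := Finset.card_le_card hsub
  rw [Finset.card_union_of_disjoint hdisj, Finset.card_image_of_injective _ Prod.swap_injective,
    Finset.offDiag_card] at this
  have h2 := Nat.le_mul_self (H.anc v).card
  omega

/-- Ancestor sets are nested along an edge, and strictly so, since `v` being an ancestor of `u`
would close a cycle. This is what makes sorting by the number of ancestors topological. -/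
lemma Adj.card_anc_lt {H : FinDigraph V} (hH : H.Acyclic) {u v : V} (h : H.Adj u v) :
    (H.anc u).card < (H.anc v).card := by
  refine Finset.card_lt_card (Finset.ssubset_iff_of_subset ?_ |>.2 ⟨v, self_mem_anc h.right_mem, ?_⟩)
  · intro w hw
    exact mem_anc.2 ⟨(mem_anc.1 hw).1, (mem_anc.1 hw).2.tail h⟩
  · intro hv
    exact hH v (Relation.TransGen.tail' (mem_anc.1 hv).2 h)

lemma mem_ancList {H : FinDigraph V} {u v : V} : u ∈ H.ancList v ↔ u ∈ H.anc v := by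
  rw [ancList, (List.mergeSort_perm _ _).mem_iff, Finset.mem_toList]

lemma length_ancList (H : FinDigraph V) (v : V) : (H.ancList v).length = (H.anc v).card := by
  rw [ancList, List.length_mergeSort, Finset.length_toList]

/-- In `ancList` every predecessor of a job is listed before the job. -/
lemma exists_lt_of_adj {H : FinDigraph V} (hH : H.Acyclic) {u w v : V} (h : H.Adj u w) {j : ℕ}
    (hj : j < (H.ancList v).length) (hw : (H.ancList v)[j] = w) :
    ∃ i, ∃ hi : i < (H.ancList v).length, i < j ∧ (H.ancList v)[i] = u := by
  have hwm : w ∈ H.anc v := by rw [← mem_ancList, ← hw]; exact List.getElem_mem hj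
  obtain ⟨i, hi, hiu⟩ := List.getElem_of_mem (mem_ancList.2 (h.mem_anc_of_mem hwm))
  refine ⟨i, hi, ?_, hiu⟩
  have hlt := h.card_anc_lt hH
  have hpw : (H.ancList v).Pairwise fun a b => (H.anc a).card ≤ (H.anc b).card := by
    have := List.pairwise_mergeSort
      (le := fun a b : V => decide ((H.anc a).card ≤ (H.anc b).card))
      (fun a b c h1 h2 => by simp only [decide_eq_true_eq] at *; exact h1.trans h2)
      (fun a b => by simpa using le_total (H.anc a).card (H.anc b).card) (H.anc v).toList
    exact this.imp (by simp)
  by_contra hcon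
  push Not at hcon
  rcases hcon.lt_or_eq with hji | rfl
  · have := List.pairwise_iff_getElem.1 hpw j i hj hi hji
    rw [hw, hiu] at this
    omega
  · rw [hiu] at hw
    subst hw
    omega

end FinDigraph

open FinDigraph
open scoped ENNReal

/-! ### A batch reduces every vertex -/

section Batch

variable {V : Type*} [DecidableEq V]

/-- What is left of `H` when the ancestors of the batch `B` have been removed. -/
def residual (H : FinDigraph V) (B : List V) : FinDigraph V := H.delete (H.ancSet B.toFinset)

/-- Compared with `H`, the graph `G` has lost all but a fraction `4γ` of the ancestors of `v`,
or of the ancestor edges. -/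
def Reduced (γ : ℝ) (H G : FinDigraph V) (v : V) : Prop :=
  ((G.anc v).card : ℝ) ≤ 4 * γ * (H.anc v).card ∨
    (H.ancEdges v ≠ ∅ ∧ ((G.ancEdges v).card : ℝ) ≤ 4 * γ * (H.ancEdges v).card)

lemma Reduced.mono {γ : ℝ} {H G G' : FinDigraph V} {v : V} (h : Reduced γ H G v)
    (hG : G'.IsSubgraph G) : Reduced γ H G' v := by
  have h1 : ((G'.anc v).card : ℝ) ≤ (G.anc v).card :=
    Nat.cast_le.2 (Finset.card_le_card (hG.anc_subset v))
  have h2 : ((G'.ancEdges v).card : ℝ) ≤ (G.ancEdges v).card :=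
    Nat.cast_le.2 (Finset.card_le_card (hG.ancEdges_subset v))
  exact h.imp (fun h => h1.trans h) fun h => ⟨h.1, h2.trans h.2⟩

lemma residual_anti (H : FinDigraph V) {B B' : List V} (h : B <+: B') :
    (residual H B').IsSubgraph (residual H B) :=
  H.delete_anti (H.ancSet_mono fun _ hv => List.mem_toFinset.2
    (h.subset (List.mem_toFinset.1 hv)))

lemma reduced_of_mem {γ : ℝ} (hγ : 0 ≤ γ) {H : FinDigraph V} {B : List V} {v : V} (hv : v ∈ B) :
    Reduced γ H (residual H B) v := by
  left
  have : v ∉ (residual H B).verts := fun h => by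
    obtain ⟨h1, h2⟩ := mem_verts_delete.1 h
    exact h2 (mem_ancSet.2 ⟨v, List.mem_toFinset.2 hv, self_mem_anc h1⟩)
  rw [anc_eq_empty this, Finset.card_empty, Nat.cast_zero]
  positivity

/-- Whatever survives the deletion lies outside the ancestors, respectively the ancestor edges, of
the batch. For a stale vertex this is a fraction at most `γ ≤ 4γ` of one of the two sets. -/
lemma reduced_of_not_fresh {γ : ℝ} (hγ : 0 ≤ γ) {H : FinDigraph V} {B : List V} {v : V}
    (hv : ¬ Fresh H γ B v) : Reduced γ H (residual H B) v := by
  have h1 : (((residual H B).anc v).card : ℝ) ≤ (H.anc v \ H.ancSet B.toFinset).card :=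
    Nat.cast_le.2 (Finset.card_le_card (H.anc_delete_subset _ v))
  have h2 : (((residual H B).ancEdges v).card : ℝ) ≤
      (H.ancEdges v \ H.ancEdgesSet B.toFinset).card :=
    Nat.cast_le.2 (Finset.card_le_card (H.ancEdges_delete_subset _ v))
  have h3 : (0 : ℝ) ≤ γ * (H.anc v).card := by positivity
  have h4 : (0 : ℝ) ≤ γ * (H.ancEdges v).card := by positivity
  rw [Fresh, not_and_or, not_or, not_lt, not_lt] at hv
  rcases hv with hv | hv
  · left; linarith
  · right; exact ⟨hv.1, by linarith [hv.2]⟩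

/-- Every element of the list was fresh for the elements before it. -/
def FreshList (H : FinDigraph V) (γ : ℝ) (B : List V) : Prop :=
  ∀ B' v, B' ++ [v] <+: B → Fresh H γ B' v

lemma FreshList.concat {H : FinDigraph V} {γ : ℝ} {B : List V} {v : V} (hB : FreshList H γ B)
    (hv : Fresh H γ B v) : FreshList H γ (B ++ [v]) := by
  intro B' w h
  rcases List.prefix_concat_iff.1 h with h | h
  · obtain ⟨rfl, h2⟩ := List.append_inj' h rfl
    simp only [List.cons.injEq, and_true] at h2
    exact h2 ▸ hv
  · exact hB B' w h

lemma Fresh.mem_verts {H : FinDigraph V} {γ : ℝ} {B : List V} {v : V}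
    (h : Fresh H γ B v) : v ∈ H.verts := by
  by_contra hv
  have := h.1
  rw [anc_eq_empty hv] at this
  simp at this

lemma FreshList.mem_verts {H : FinDigraph V} {γ : ℝ} {B : List V}
    (h : FreshList H γ B) {v : V} (hv : v ∈ B) : v ∈ H.verts := by
  obtain ⟨s, t, rfl⟩ := List.append_of_mem hv
  exact (h s v ⟨t, by simp⟩).mem_verts

/-- The total size of the ancestor sets is at most `1/γ` times the size of their union. -/
lemma FreshList.sum_card_le {H : FinDigraph V} {γ : ℝ} {B : List V} (h : FreshList H γ B) :
    γ * ((B.map fun v => (H.anc v).card).sum : ℕ) ≤ (H.ancSet B.toFinset).card := by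
  induction B using List.reverseRecOn with
  | nil => simp
  | append_singleton B v ih =>
    have h1 := ih fun B' w hw => h B' w (hw.trans (List.prefix_append _ _))
    have h2 := (h B v (List.prefix_refl _)).1
    have h3 : (H.ancSet (B ++ [v]).toFinset) =
        (H.anc v \ H.ancSet B.toFinset) ∪ H.ancSet B.toFinset := by
      rw [Finset.sdiff_union_self_eq_union, ← ancSet_insert]
      congr 1
      ext; simp
    rw [h3, Finset.card_union_of_disjoint Finset.sdiff_disjoint]
    simp only [List.map_append, List.map_cons, List.map_nil, List.sum_append, List.sum_cons,
      List.sum_nil, Nat.cast_add, Nat.cast_zero]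
    linarith

/-- This makes the first vertex sampled enter the batch, so the batch is non-empty and the outer
loop deletes something. -/
lemma fresh_nil {H : FinDigraph V} {γ : ℝ} (hγ : γ < 1) {v : V} (hv : v ∈ H.verts) :
    Fresh H γ [] v := by
  have h1 : H.ancSet ([] : List V).toFinset = ∅ := rfl
  have h2 : H.ancEdgesSet ([] : List V).toFinset = ∅ := by
    rw [ancEdgesSet, h1]
    exact Finset.eq_empty_of_forall_notMem fun e he => by simp [mem_inducedEdges] at he
  rw [Fresh, h1, h2, Finset.sdiff_empty, Finset.sdiff_empty]
  have h3 : (0 : ℝ) < (H.anc v).card := by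
    exact_mod_cast Finset.card_pos.2 ⟨v, self_mem_anc hv⟩
  refine ⟨by nlinarith, or_iff_not_imp_left.2 fun h => ?_⟩
  have h4 : (0 : ℝ) < (H.ancEdges v).card := by
    exact_mod_cast Finset.card_pos.2 (Finset.nonempty_iff_ne_empty.2 h)
  nlinarith

/-- Outcome of sampling from one bucket. -/
lemma sampleBucket_spec {H : FinDigraph V} {γ : ℝ} (hγ : 0 ≤ γ) {N : ℕ} (fuel : ℕ) :
    ∀ (s : ℕ) (K : Finset V) (B : List V), ∀ r ∈ (sampleBucket H γ N fuel s K B).support,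
      r.1 ⊆ K ∧ B <+: r.2 ∧ (FreshList H γ B → FreshList H γ r.2) ∧
        ∀ v ∈ K, v ∉ r.1 → Reduced γ H (residual H r.2) v := by
  induction fuel with
  | zero =>
    intro s K B r hr
    rw [sampleBucket, PMF.mem_support_pure_iff] at hr
    subst hr
    exact ⟨le_rfl, List.prefix_refl _, id, fun v h1 h2 => absurd h1 h2⟩
  | succ fuel ih =>
    intro s K B r hr
    rw [sampleBucket] at hr
    split_ifs at hr with h
    · obtain ⟨v, hv, hr⟩ := (PMF.mem_support_bind_iff _ _ _).1 hr
      split_ifs at hr with hfr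
      · obtain ⟨h1, h2, h3, h4⟩ := ih _ _ _ r hr
        refine ⟨h1.trans (Finset.erase_subset _ _), (List.prefix_append _ _).trans h2,
          fun hB => h3 (hB.concat hfr), fun w hw hw' => ?_⟩
        by_cases hwv : w = v
        · exact reduced_of_mem hγ (h2.subset (by simp [hwv]))
        · exact h4 w (Finset.mem_erase.2 ⟨hwv, hw⟩) hw'
      · obtain ⟨h1, h2, h3, h4⟩ := ih _ _ _ r hr
        refine ⟨h1.trans (Finset.erase_subset _ _), h2, h3, fun w hw hw' => ?_⟩
        by_cases hwv : w = v
        · exact hwv ▸ (reduced_of_not_fresh hγ hfr).mono (residual_anti H h2)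
        · exact h4 w (Finset.mem_erase.2 ⟨hwv, hw⟩) hw'
    · rw [PMF.mem_support_pure_iff] at hr
      subst hr
      exact ⟨le_rfl, List.prefix_refl _, id, fun v h1 h2 => absurd h1 h2⟩

/-- Sampling from a non-empty bucket removes a vertex, and leaves a non-empty batch. -/
lemma sampleBucket_progress {H : FinDigraph V} {γ : ℝ} (hγ : 0 ≤ γ) (hγ1 : γ < 1) {N : ℕ}
    (hN : 1 ≤ N) {K : Finset V} (hK : K.Nonempty) (hKH : K ⊆ H.verts) (B : List V) :
    ∀ r ∈ (sampleBucket H γ N K.card 0 K B).support, r.1.card < K.card ∧ r.2 ≠ [] := by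
  intro r hr
  obtain ⟨m, hm⟩ : ∃ m, K.card = m + 1 := ⟨K.card - 1, by have := hK.card_pos; omega⟩
  rw [hm, sampleBucket, dif_pos ⟨hN, hK⟩] at hr
  obtain ⟨v, hv, hr⟩ := (PMF.mem_support_bind_iff _ _ _).1 hr
  rw [PMF.mem_support_uniformOfFinset_iff] at hv
  split_ifs at hr with hfr
  · obtain ⟨h1, h2, -⟩ := sampleBucket_spec hγ _ _ _ _ r hr
    refine ⟨(Finset.card_le_card h1).trans_lt (Finset.card_erase_lt_of_mem hv), ?_⟩
    rintro h
    rw [h] at h2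
    simp at h2
  · obtain ⟨h1, h2, -⟩ := sampleBucket_spec hγ _ _ _ _ r hr
    refine ⟨(Finset.card_le_card h1).trans_lt (Finset.card_erase_lt_of_mem hv), ?_⟩
    rintro h
    rw [h, List.prefix_nil] at h2
    exact hfr (h2 ▸ fresh_nil hγ1 (hKH hv))

/-- Reductions obtained in one bucket persist while later buckets are processed, because the batch
only grows and the residual graph only shrinks. -/
lemma sweepBuckets_spec {H : FinDigraph V} {γ : ℝ} (hγ : 0 ≤ γ) {N : ℕ} (i : ℕ) :
    ∀ (K : ℕ → Finset V) (B : List V), ∀ r ∈ (sweepBuckets H γ N i K B).support,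
      (∀ j, r.1 j ⊆ K j) ∧ B <+: r.2 ∧ (FreshList H γ B → FreshList H γ r.2) ∧
        ∀ j, ∀ v ∈ K j, v ∉ r.1 j → Reduced γ H (residual H r.2) v := by
  induction i with
  | zero =>
    intro K B r hr
    rw [sweepBuckets, PMF.mem_support_pure_iff] at hr
    subst hr
    exact ⟨fun _ => le_rfl, List.prefix_refl _, id, fun j v h1 h2 => absurd h1 h2⟩
  | succ i ih =>
    intro K B r hr
    rw [sweepBuckets] at hr
    obtain ⟨q, hq, hr⟩ := (PMF.mem_support_bind_iff _ _ _).1 hr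
    obtain ⟨a1, a2, a3, a4⟩ := sampleBucket_spec hγ _ _ _ _ q hq
    obtain ⟨b1, b2, b3, b4⟩ := ih _ _ r hr
    have hup : ∀ j, Function.update K (i + 1) q.1 j ⊆ K j := by
      intro j
      by_cases hj : j = i + 1
      · subst hj; rw [Function.update_self]; exact a1
      · rw [Function.update_of_ne hj]
    refine ⟨fun j => (b1 j).trans (hup j), a2.trans b2, fun hB => b3 (a3 hB), ?_⟩
    intro j v hv hv'
    by_cases hvu : v ∈ Function.update K (i + 1) q.1 j
    · exact b4 j v hvu hv'
    · by_cases hj : j = i + 1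
      · subst hj
        rw [Function.update_self] at hvu
        exact (a4 v hv hvu).mono (residual_anti H b2)
      · rw [Function.update_of_ne hj] at hvu
        exact absurd hv hvu

lemma sweepBuckets_progress {H : FinDigraph V} {γ : ℝ} (hγ : 0 ≤ γ) (hγ1 : γ < 1) {N : ℕ}
    (hN : 1 ≤ N) (i : ℕ) :
    ∀ (K : ℕ → Finset V) (B : List V), (∃ j ∈ Finset.Icc 1 i, (K j).Nonempty) →
      (∀ j, K j ⊆ H.verts) → ∀ r ∈ (sweepBuckets H γ N i K B).support,
      (∃ j ∈ Finset.Icc 1 i, (r.1 j).card < (K j).card) ∧ r.2 ≠ [] := by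
  induction i with
  | zero => rintro K B ⟨j, hj, -⟩; simp at hj
  | succ i ih =>
    intro K B hex hKH r hr
    rw [sweepBuckets] at hr
    obtain ⟨q, hq, hr⟩ := (PMF.mem_support_bind_iff _ _ _).1 hr
    by_cases hne : (K (i + 1)).Nonempty
    · obtain ⟨a1, a2⟩ := sampleBucket_progress hγ hγ1 hN hne (hKH _) B q hq
      obtain ⟨b1, b2, -⟩ := sweepBuckets_spec hγ _ _ _ r hr
      refine ⟨⟨i + 1, by simp, ?_⟩, fun h => ?_⟩
      · have := b1 (i + 1)
        rw [Function.update_self] at this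
        exact (Finset.card_le_card this).trans_lt a1
      · rw [h, List.prefix_nil] at b2
        exact a2 b2
    · obtain ⟨j, hj, hjne⟩ := hex
      have hji : j ≠ i + 1 := by rintro rfl; exact hne hjne
      have hj' : j ∈ Finset.Icc 1 i := by
        rw [Finset.mem_Icc] at hj ⊢; omega
      obtain ⟨a1, -⟩ := sampleBucket_spec hγ _ _ _ _ q hq
      have hup : ∀ j, Function.update K (i + 1) q.1 j ⊆ K j := by
        intro j
        by_cases hj : j = i + 1
        · subst hj; rw [Function.update_self]; exact a1
        · rw [Function.update_of_ne hj]
      obtain ⟨⟨l, hl, hlt⟩, h2⟩ := ih _ _ ⟨j, hj', by rwa [Function.update_of_ne hji]⟩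
        (fun j => (hup j).trans (hKH j)) r hr
      refine ⟨⟨l, ?_, hlt.trans_le (Finset.card_le_card (hup l))⟩, h2⟩
      rw [Finset.mem_Icc] at hl ⊢; omega

/-- An upper error 4/3 on the denominator against a lower error 2/3 on the numerator loses a factor
2, turning the test value `2γ` into `4γ`. -/
lemma ratio_le_of_goodEstimate {γ : ℝ} {a b : ℕ} {x y : ℝ} (ha : 0 < a) (hx : GoodEstimate a x)
    (hy : GoodEstimate b y) (h : y / x ≤ 2 * γ) : (b : ℝ) ≤ 4 * γ * a := by
  have ha' : (0 : ℝ) < a := by exact_mod_cast ha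
  have hx0 : 0 < x := by linarith [hx.1]
  rw [div_le_iff₀ hx0] at h
  have hγ : 0 ≤ γ := by
    have hb : (0 : ℝ) ≤ b := by positivity
    by_contra hc
    push Not at hc
    nlinarith [hy.1]
  nlinarith [hy.1, hx.2]

variable [Fintype V]

/-- Pruning removes, with high probability, only vertices that have been reduced. -/
lemma failProb_prune_le {P : EstimatorParams V} {δ : ℝ≥0∞}
    (hδ : ∀ G : FinDigraph V, failProb (obtainEstimates P G) (GoodEstimates G) ≤ δ)
    (H : FinDigraph V) (γ : ℝ) (B : List V) (K : ℕ → Finset V) (hK : ∀ i, K i ⊆ H.verts) :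
    failProb (prune P H γ B K) (fun K' => (∀ i, K' i ⊆ K i) ∧
      ∀ i, ∀ v ∈ K i, v ∉ K' i → Reduced γ H (residual H B) v) ≤ 2 * δ := by
  rw [prune, two_mul δ]
  refine failProb_bind_le (hδ H) fun e _ he => ?_
  rw [← add_zero δ]
  refine failProb_bind_le (hδ _) fun e' _ he' => le_of_eq (failProb_eq_zero fun K' hK' => ?_)
  rw [PMF.mem_support_pure_iff] at hK'
  subst hK'
  refine ⟨fun i => Finset.filter_subset _ _, fun i v hv hv' => ?_⟩
  rw [Finset.mem_filter, not_and, not_not] at hv'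
  rcases hv' hv with h | ⟨h0, h⟩
  · exact .inl (ratio_le_of_goodEstimate (Finset.card_pos.2 ⟨v, self_mem_anc (hK i hv)⟩)
      (he v).1 (he' v).1 h)
  · exact .inr ⟨h0, ratio_le_of_goodEstimate
      (Finset.card_pos.2 (Finset.nonempty_iff_ne_empty.2 h0)) (he v).2 (he' v).2 h⟩

/-- A batch as it should be: non-empty, of fresh vertices, and reducing every vertex. -/
structure GoodBatch (H : FinDigraph V) (γ : ℝ) (B : List V) : Prop where
  fresh : FreshList H γ B
  ne_nil : B ≠ []
  reduced : ∀ v ∈ H.verts, Reduced γ H (residual H B) v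

/-- Invariant: each vertex is still in a bucket or already reduced. When the buckets are empty,
every vertex is reduced. Each round empties the buckets by at least one vertex, so the fuel suffices
and bounds the number of prunings. -/
lemma failProb_batchLoop_le {P : EstimatorParams V} {δ : ℝ≥0∞}
    (hδ : ∀ G : FinDigraph V, failProb (obtainEstimates P G) (GoodEstimates G) ≤ δ)
    (H : FinDigraph V) {γ : ℝ} (hγ : 0 ≤ γ) (hγ1 : γ < 1) {N : ℕ} (hN : 1 ≤ N) (k fuel : ℕ) :
    ∀ (K : ℕ → Finset V) (B : List V), (∀ j, K j ⊆ H.verts) → FreshList H γ B →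
      (∀ v ∈ H.verts, (∃ j ∈ Finset.Icc 1 k, v ∈ K j) ∨ Reduced γ H (residual H B) v) →
      (B ≠ [] ∨ ∃ j ∈ Finset.Icc 1 k, (K j).Nonempty) →
      ∑ j ∈ Finset.Icc 1 k, (K j).card ≤ fuel →
      failProb (batchLoop P H γ N k fuel K B) (GoodBatch H γ) ≤ fuel * (2 * δ) := by
  have hdone : ∀ (K : ℕ → Finset V) (B : List V), FreshList H γ B →
      (∀ v ∈ H.verts, (∃ j ∈ Finset.Icc 1 k, v ∈ K j) ∨ Reduced γ H (residual H B) v) →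
      (B ≠ [] ∨ ∃ j ∈ Finset.Icc 1 k, (K j).Nonempty) →
      (¬ ∃ j ∈ Finset.Icc 1 k, (K j).Nonempty) → GoodBatch H γ B := by
    intro K B hB hred hne hnot
    exact ⟨hB, hne.resolve_right hnot, fun v hv => (hred v hv).resolve_left
      fun ⟨j, hj, hvj⟩ => hnot ⟨j, hj, v, hvj⟩⟩
  induction fuel with
  | zero =>
    intro K B hK hB hred hne hsum
    rw [batchLoop, failProb_eq_zero]
    · exact zero_le
    · intro B' hB'
      rw [PMF.mem_support_pure_iff] at hB'
      subst hB'
      refine hdone K B' hB hred hne ?_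
      rintro ⟨j, hj, hjne⟩
      have := Finset.single_le_sum (f := fun j => (K j).card) (fun _ _ => Nat.zero_le _) hj
      have := hjne.card_pos
      omega
  | succ fuel ih =>
    intro K B hK hB hred hne hsum
    rw [batchLoop]
    split_ifs with hex
    -- The sampling can go either way without harm: every outcome preserves the invariant, so only
    -- the pruning contributes to the failure probability.
    · refine failProb_bind_le_right fun r hr => ?_
      obtain ⟨a1, a2, a3, a4⟩ := sweepBuckets_spec hγ _ _ _ r hr
      obtain ⟨⟨l, hl, hlt⟩, hr2⟩ := sweepBuckets_progress hγ hγ1 hN _ _ _ hex hK r hr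
      push_cast
      rw [add_mul, one_mul, add_comm]
      refine failProb_bind_le (failProb_prune_le hδ H γ r.2 r.1
        fun i => (a1 i).trans (hK i)) fun K' _ hK' => ?_
      obtain ⟨b1, b2⟩ := hK'
      refine ih K' r.2 (fun j => (b1 j).trans ((a1 j).trans (hK j))) (a3 hB) ?_ (.inl hr2) ?_
      · intro v hv
        rcases hred v hv with ⟨j, hj, hvj⟩ | h
        · by_cases h1 : v ∈ r.1 j
          · by_cases h2 : v ∈ K' j
            · exact .inl ⟨j, hj, h2⟩
            · exact .inr (b2 j v h1 h2)
          · exact .inr (a4 j v hvj h1)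
        · exact .inr (h.mono (residual_anti H a2))
      · have : ∑ j ∈ Finset.Icc 1 k, (K' j).card < ∑ j ∈ Finset.Icc 1 k, (K j).card :=
          Finset.sum_lt_sum (fun j _ => Finset.card_le_card ((b1 j).trans (a1 j)))
            ⟨l, hl, (Finset.card_le_card (b1 l)).trans_lt hlt⟩
        omega
    · rw [failProb_eq_zero]
      · exact zero_le
      · intro B' hB'
        rw [PMF.mem_support_pure_iff] at hB'
        subst hB'
        exact hdone K B' hB hred hne hex

lemma failProb_findBatch_le {P : EstimatorParams V} {δ : ℝ≥0∞}
    (hδ : ∀ G : FinDigraph V, failProb (obtainEstimates P G) (GoodEstimates G) ≤ δ)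
    {H : FinDigraph V} (hH : H.verts.Nonempty) {γ : ℝ} (hγ : 0 ≤ γ) (hγ1 : γ < 1) {N : ℕ}
    (hN : 1 ≤ N) :
    failProb (findBatch P H γ N) (GoodBatch H γ) ≤ Fintype.card V * (2 * δ) := by
  rw [findBatch]
  -- These estimates only sort the vertices into buckets; any outcome is acceptable.
  refine failProb_bind_le_right fun e _ => ?_
  have hmem : ∀ v ∈ H.verts, bucketIndex (e.2 v) ∈
      Finset.Icc 1 (H.verts.sup fun v => bucketIndex (e.2 v)) := fun v hv =>
    Finset.mem_Icc.2 ⟨le_max_left _ _, Finset.le_sup (f := fun v => bucketIndex (e.2 v)) hv⟩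
  refine (failProb_batchLoop_le hδ H hγ hγ1 hN _ _ _ _ (fun j => Finset.filter_subset _ _)
    ?_ ?_ ?_ ?_).trans ?_
  · intro B' v h
    simp at h
  · exact fun v hv => .inl ⟨_, hmem v hv, Finset.mem_filter.2 ⟨hv, rfl⟩⟩
  · obtain ⟨v, hv⟩ := hH
    exact .inr ⟨_, hmem v hv, v, Finset.mem_filter.2 ⟨hv, rfl⟩⟩
  · exact (Finset.card_eq_sum_card_fiberwise hmem).ge
  · gcongr
    exact Finset.card_le_univ _

end Batch

/-! ### How many batches a vertex can survive -/

section ShrinkingSequences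

/-- The numbers `a i` of ancestors and `e i` of ancestor edges of a vertex that survives `n`
batches: each batch divides one of the two numbers by `g`. -/
structure ShrinkSeq (g : ℝ) (ρ n : ℕ) (a e : ℕ → ℕ) : Prop where
  start : a 0 ≤ 2 * ρ
  pos : ∀ i ≤ n, 1 ≤ a i
  le_edges : ∀ i ≤ n, a i ≤ e i + 1
  edges_le : ∀ i ≤ n, 2 * e i + a i ≤ a i * a i
  anti_a : ∀ i < n, a (i + 1) ≤ a i
  anti_e : ∀ i < n, e (i + 1) ≤ e i
  step : ∀ i < n, g * a (i + 1) ≤ a i ∨ (1 ≤ e i ∧ g * e (i + 1) ≤ e i)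

variable {g : ℝ} {ρ n : ℕ} {a e : ℕ → ℕ}

lemma ShrinkSeq.mono (h : ShrinkSeq g ρ n a e) {m : ℕ} (hm : m ≤ n) : ShrinkSeq g ρ m a e where
  start := h.start
  pos i hi := h.pos i (hi.trans hm)
  le_edges i hi := h.le_edges i (hi.trans hm)
  edges_le i hi := h.edges_le i (hi.trans hm)
  anti_a i hi := h.anti_a i (hi.trans_le hm)
  anti_e i hi := h.anti_e i (hi.trans_le hm)
  step i hi := h.step i (hi.trans_le hm)

lemma ShrinkSeq.edges_start (h : ShrinkSeq g ρ n a e) : (e 0 : ℝ) ≤ ρ * (2 * ρ - 1) := by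
  have h1 := h.edges_le 0 (Nat.zero_le _)
  have h2 := h.start
  have h3 := h.pos 0 (Nat.zero_le _)
  have h1' : 2 * (e 0 : ℝ) + a 0 ≤ a 0 * a 0 := by exact_mod_cast h1
  have h2' : (a 0 : ℝ) ≤ 2 * ρ := by exact_mod_cast h2
  have h3' : (1 : ℝ) ≤ a 0 := by exact_mod_cast h3
  nlinarith

/-- Before the last batch but one there is still an ancestor edge. -/
lemma ShrinkSeq.one_le_edges (hg : 1 < g) {m : ℕ} (h : ShrinkSeq g ρ (m + 1) a e) : 1 ≤ e m := by
  -- A step that shrinks the ancestors but leaves at least one needs `a m ≥ g > 1`, hence an edge. A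
  -- step that shrinks the edges includes `1 ≤ e m`.
  rcases h.step m (Nat.lt_succ_self m) with h1 | h1
  · by_contra hc
    have h2 := h.le_edges m (Nat.le_succ m)
    have h3 : (1 : ℝ) ≤ a (m + 1) := by exact_mod_cast h.pos (m + 1) le_rfl
    have h4 : (a m : ℝ) ≤ 1 := by exact_mod_cast (by omega : a m ≤ 1)
    nlinarith
  · exact h1.1

lemma two_le_of_edges {a e : ℕ} (h : 2 * e + a ≤ a * a) (he : 1 ≤ e) : 2 ≤ a := by
  by_contra hc
  have : a = 0 ∨ a = 1 := by omega
  rcases this with rfl | rfl <;> omega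

/-- The batches split into those that shrink the ancestors and those that shrink the edges. -/
lemma ShrinkSeq.exists_split (hg : 1 < g) (h : ShrinkSeq g ρ n a e) :
    ∃ k₁ k₂ : ℕ, k₁ + k₂ = n ∧ g ^ k₁ * a n ≤ 2 * ρ ∧ g ^ k₂ * e n ≤ e 0 := by
  induction n with
  | zero => exact ⟨0, 0, rfl, by simpa using (by exact_mod_cast h.start : (a 0 : ℝ) ≤ 2 * ρ), by simp⟩
  | succ n ih =>
    obtain ⟨k₁, k₂, hk, h1, h2⟩ := ih (h.mono (Nat.le_succ n))
    have ha : (a (n + 1) : ℝ) ≤ a n := by exact_mod_cast h.anti_a n (Nat.lt_succ_self n)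
    have he : (e (n + 1) : ℝ) ≤ e n := by exact_mod_cast h.anti_e n (Nat.lt_succ_self n)
    have p1 : 0 < g ^ k₁ := by positivity
    have p2 : 0 < g ^ k₂ := by positivity
    rcases h.step n (Nat.lt_succ_self n) with h3 | ⟨-, h3⟩
    · refine ⟨k₁ + 1, k₂, by omega, ?_, ?_⟩
      · rw [pow_succ, mul_assoc]
        exact (mul_le_mul_of_nonneg_left h3 p1.le).trans h1
      · exact (mul_le_mul_of_nonneg_left he p2.le).trans h2
    · refine ⟨k₁, k₂ + 1, by omega, ?_, ?_⟩
      · exact (mul_le_mul_of_nonneg_left ha p1.le).trans h1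
      · rw [pow_succ, mul_assoc]
        exact (mul_le_mul_of_nonneg_left h3 p2.le).trans h2

/-- No vertex survives four batches if `g ^ 5 > (2ρ) ^ 4`. -/
lemma ShrinkSeq.not_four (hg : 1 < g) (hρ : 2 ≤ ρ) (hgR : (2 * ρ : ℝ) ^ 4 < g ^ 5)
    (h : ShrinkSeq g ρ 4 a e) : False := by
  have hρ' : (2 : ℝ) ≤ ρ := by exact_mod_cast hρ
  have hR3 : (2 * ρ : ℝ) ^ 2 < g ^ 3 := by
    refine lt_of_pow_lt_pow_left₀ 2 (by positivity) ?_
    calc ((2 * ρ : ℝ) ^ 2) ^ 2 = (2 * ρ : ℝ) ^ 4 := by ring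
      _ < g ^ 5 := hgR
      _ ≤ g ^ 6 := pow_le_pow_right₀ hg.le (by norm_num)
      _ = (g ^ 3) ^ 2 := by ring
  have hR2 : (2 * ρ : ℝ) < g ^ 2 := by
    refine lt_of_pow_lt_pow_left₀ 4 (by positivity) ?_
    calc (2 * ρ : ℝ) ^ 4 < g ^ 5 := hgR
      _ ≤ g ^ 8 := pow_le_pow_right₀ hg.le (by norm_num)
      _ = (g ^ 2) ^ 4 := by ring
  have he3 : 1 ≤ e 3 := h.one_le_edges hg
  have ha3 : 2 ≤ a 3 := two_le_of_edges (h.edges_le 3 (by norm_num)) he3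
  have he3' : (1 : ℝ) ≤ e 3 := by exact_mod_cast he3
  have ha3' : (2 : ℝ) ≤ a 3 := by exact_mod_cast ha3
  have a0 : (a 0 : ℝ) ≤ 2 * ρ := by exact_mod_cast h.start
  have a1 : (a 1 : ℝ) ≤ a 0 := by exact_mod_cast h.anti_a 0 (by norm_num)
  have a2 : (a 2 : ℝ) ≤ a 1 := by exact_mod_cast h.anti_a 1 (by norm_num)
  have e0 := h.edges_start
  have e2 : 2 * (e 2 : ℝ) + a 2 ≤ a 2 * a 2 := by exact_mod_cast h.edges_le 2 (by norm_num)
  have ae2 : (a 2 : ℝ) ≤ e 2 + 1 := by exact_mod_cast h.le_edges 2 (by norm_num)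
  have pa2 : (0 : ℝ) ≤ a 2 := by positivity
  have hg0 : 0 < g := by linarith
  -- The first two batches either shrink the ancestors at least once or shrink the edges twice.
  have first : g * a 2 ≤ 2 * ρ ∨ g ^ 2 * e 2 ≤ e 0 := by
    rcases h.step 0 (by norm_num) with s0 | ⟨-, s0⟩
    · left; simp only [zero_add] at s0; nlinarith
    · rcases h.step 1 (by norm_num) with s1 | ⟨-, s1⟩
      · left; simp only [Nat.reduceAdd] at s1; linarith
      · right
        simp only [Nat.reduceAdd, zero_add] at s0 s1
        nlinarith
  have second : g * a 3 ≤ a 2 ∨ g * e 3 ≤ e 2 := (h.step 2 (by norm_num)).imp id And.right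
  -- With `g² > 2ρ` and `g³ > (2ρ)²`, two ancestor steps or three edge steps are too many. A mixture
  -- is excluded by passing between the two counts: `2e ≤ a²` when the edges shrink last, `a ≤ e +
  -- 1` when the ancestors do.
  rcases first with f | f <;> rcases second with s | s
  · have : g ^ 2 * a 3 ≤ 2 * ρ := by nlinarith
    nlinarith [sq_nonneg g]
  · have h1 : (g * a 2) ^ 2 ≤ (2 * ρ) ^ 2 := pow_le_pow_left₀ (by positivity) f 2
    have h2 : g ^ 2 * (2 * e 2) ≤ g ^ 2 * (a 2 * a 2) :=
      mul_le_mul_of_nonneg_left (by linarith) (by positivity)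
    have h3 : g ^ 2 * (g * e 3) ≤ g ^ 2 * e 2 := mul_le_mul_of_nonneg_left s (by positivity)
    have h4 : g ^ 3 * 1 ≤ g ^ 3 * e 3 := mul_le_mul_of_nonneg_left he3' (by positivity)
    nlinarith
  · have h1 : g ^ 2 * (2 * g) ≤ g ^ 2 * (e 2 + 1) :=
      mul_le_mul_of_nonneg_left (by nlinarith) (by positivity)
    have h2 : g ^ 2 < g ^ 3 := pow_lt_pow_right₀ hg (by norm_num)
    nlinarith
  · have h3 : g ^ 2 * (g * e 3) ≤ g ^ 2 * e 2 := mul_le_mul_of_nonneg_left s (by positivity)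
    have h4 : g ^ 3 * 1 ≤ g ^ 3 * e 3 := mul_le_mul_of_nonneg_left he3' (by positivity)
    nlinarith

/-- How many batches a vertex can survive. -/
lemma ShrinkSeq.length_cases (hg : 1 < g) (hρ : 2 ≤ ρ) (hgR : g ≤ (2 * ρ : ℝ) ^ 2)
    (h : ShrinkSeq g ρ n a e) :
    g ^ (n + 1) ≤ (2 * ρ : ℝ) ^ 4 ∨ (n = 2 ∧ (2 * ρ : ℝ) ^ 4 < g ^ 3) := by
  have hρ' : (2 : ℝ) ≤ ρ := by exact_mod_cast hρ
  by_contra hc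
  rw [not_or, not_le, not_and] at hc
  obtain ⟨hc1, hc2⟩ := hc
  -- Under the contrary assumption `g^(n+1) > (2ρ)^4`, any power of `g` up to `(2ρ)^4` has exponent
  -- at most `n`.
  have key : ∀ k : ℕ, g ^ k ≤ (2 * ρ : ℝ) ^ 4 → k < n + 1 := by
    intro k hk
    by_contra hcon
    push Not at hcon
    exact absurd (hc1.trans_le (pow_le_pow_right₀ hg.le hcon)) (not_lt.2 hk)
  have hn2 : 2 < n + 1 := key 2 (by nlinarith)
  obtain ⟨m, rfl⟩ : ∃ m, n = m + 1 := ⟨n - 1, by omega⟩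
  have he : 1 ≤ e m := h.one_le_edges hg
  have ha : 2 ≤ a m := two_le_of_edges (h.edges_le m (Nat.le_succ m)) he
  obtain ⟨k₁, k₂, hk, h1, h2⟩ := (h.mono (Nat.le_succ m)).exists_split hg
  have he' : (1 : ℝ) ≤ e m := by exact_mod_cast he
  have ha' : (2 : ℝ) ≤ a m := by exact_mod_cast ha
  have p1 : 0 < g ^ k₁ := by positivity
  have p2 : 0 < g ^ k₂ := by positivity
  have b1 : g ^ k₁ ≤ 2 * ρ := by nlinarith
  have b2 : g ^ k₂ ≤ (2 * ρ) ^ 2 := by nlinarith [h.edges_start]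
  have c1 : k₁ * 4 < m + 1 + 1 := key _ (by
    rw [pow_mul]; exact pow_le_pow_left₀ p1.le b1 4)
  have c2 : k₂ * 2 < m + 1 + 1 := key _ (by
    rw [pow_mul]
    calc (g ^ k₂) ^ 2 ≤ ((2 * ρ : ℝ) ^ 2) ^ 2 := pow_le_pow_left₀ p2.le b2 2
      _ = _ := by ring)
  -- From `k₁ + k₂ = m ≥ 1`, `4k₁ ≤ m + 1` and `2k₂ ≤ m + 1`: the real bound only gives `m ≤ 3`, and
  -- integrality excludes 2.
  have : m = 1 ∨ m = 3 := by omega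
  rcases this with rfl | rfl
  · exact hc2 rfl hc1
  · exact h.not_four hg hρ hc1

/-- Here `g > 2ρ`, so the first batch cannot merely shrink the ancestors, as less than one would
remain. It must shrink the edges, from at most `ρ(2ρ - 1)` to at most `ρ - 2`. -/
lemma ShrinkSeq.small_after_one (hg : 1 < g) (hρ : 2 ≤ ρ) (hgR : (2 * ρ : ℝ) ^ 4 < g ^ 3)
    (h : ShrinkSeq g ρ 1 a e) : 2 * ρ < g ∧ e 1 + 2 ≤ ρ ∧ a 1 + 1 ≤ ρ := by
  have hρ' : (2 : ℝ) ≤ ρ := by exact_mod_cast hρ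
  have hRg : 2 * ρ < g := by
    refine lt_of_pow_lt_pow_left₀ 3 (by positivity) (lt_of_le_of_lt ?_ hgR)
    exact pow_le_pow_right₀ (by linarith) (by norm_num)
  have a0 : (a 0 : ℝ) ≤ 2 * ρ := by exact_mod_cast h.start
  have e0 := h.edges_start
  have a1 : (1 : ℝ) ≤ a 1 := by exact_mod_cast h.pos 1 le_rfl
  have he : e 1 + 2 ≤ ρ := by
    rcases h.step 0 (by norm_num) with s | ⟨-, s⟩
    · simp only [zero_add] at s; nlinarith
    · simp only [zero_add] at s
      by_contra hc
      have h1 : (ρ : ℝ) - 1 ≤ e 1 := by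
        have : ρ ≤ e 1 + 1 := by omega
        have : (ρ : ℝ) ≤ e 1 + 1 := by exact_mod_cast this
        linarith
      -- Cubing allows `g³ > (2ρ)^4` to be used. With `2ρ - 1 ≤ 3(ρ - 1)` one gets `16ρ^4 < 27ρ³`,
      -- impossible for `ρ ≥ 2`.
      obtain ⟨s', hs⟩ : ∃ s : ℝ, s = ρ - 1 := ⟨_, rfl⟩
      have hs1 : 1 ≤ s' := by linarith
      have h2 : g * s' ≤ ρ * (2 * ρ - 1) := by nlinarith
      have h3 : (g * s') ^ 3 ≤ (ρ * (2 * ρ - 1)) ^ 3 := pow_le_pow_left₀ (by positivity) h2 3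
      have h4 : (2 * ρ : ℝ) ^ 4 * s' ^ 3 < g ^ 3 * s' ^ 3 :=
        mul_lt_mul_of_pos_right hgR (by positivity)
      have h5 : ((2 * ρ - 1 : ℝ)) ^ 3 ≤ (3 * s') ^ 3 :=
        pow_le_pow_left₀ (by linarith) (by linarith) 3
      have h6 : (ρ : ℝ) ^ 3 * (2 * ρ - 1) ^ 3 ≤ ρ ^ 3 * (3 * s') ^ 3 :=
        mul_le_mul_of_nonneg_left h5 (by positivity)
      have h7 : (ρ : ℝ) ^ 3 * s' ^ 3 * 2 ≤ ρ ^ 3 * s' ^ 3 * ρ :=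
        mul_le_mul_of_nonneg_left hρ' (by positivity)
      have h8 : 0 < (ρ : ℝ) ^ 3 * s' ^ 3 := by positivity
      nlinarith
  exact ⟨hRg, he, by have := h.le_edges 1 le_rfl; omega⟩

/-- After one batch both counts are below `g`. A second ancestor step would leave none, and an edge
step leaves no edge, hence only the vertex itself. -/
lemma ShrinkSeq.small_after_two (hg : 1 < g) (hρ : 2 ≤ ρ) (hgR : (2 * ρ : ℝ) ^ 4 < g ^ 3)
    (h : ShrinkSeq g ρ 2 a e) : a 2 ≤ 1 := by
  obtain ⟨h1, h2, h3⟩ := (h.mono one_le_two).small_after_one hg hρ hgR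
  have h2' : (e 1 : ℝ) + 2 ≤ ρ := by exact_mod_cast h2
  have h3' : (a 1 : ℝ) + 1 ≤ ρ := by exact_mod_cast h3
  have a2 : (1 : ℝ) ≤ a 2 := by exact_mod_cast h.pos 2 le_rfl
  rcases h.step 1 one_lt_two with s | ⟨-, s⟩
  · simp only [Nat.reduceAdd] at s; nlinarith
  · simp only [Nat.reduceAdd] at s
    have : e 2 = 0 := by
      by_contra hc
      have : (1 : ℝ) ≤ e 2 := by exact_mod_cast Nat.one_le_iff_ne_zero.2 hc
      nlinarith
    have := h.le_edges 2 le_rfl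
    omega

end ShrinkingSequences

/-! ### Total overhead of a chain of batches -/

section Chains

variable {V : Type*} [DecidableEq V]

/-- `G'` arises from `G` by a batch that reduces every vertex. -/
def GoodStep (γ : ℝ) (G G' : FinDigraph V) : Prop :=
  G'.IsSubgraph G ∧ ∀ v ∈ G.verts, Reduced γ G G' v

/-- The time for a batch of `G` that exceeds the average load of the machines. -/
def batchCost (ρ : ℕ) (G : FinDigraph V) : ℕ := ρ + G.verts.sup fun v => (G.anc v).card

lemma shrinkSeq_of_goodStep {γ : ℝ} (hγ : 0 < γ) {ρ n : ℕ} {G : ℕ → FinDigraph V}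
    (hac : (G 0).Acyclic) (hsm : (G 0).IsSmall ρ) (hG : ∀ i < n, GoodStep γ (G i) (G (i + 1)))
    {v : V} (hv : v ∈ (G n).verts) :
    ShrinkSeq (1 / (4 * γ)) ρ n (fun i => ((G i).anc v).card)
      (fun i => ((G i).ancEdges v).card) := by
  have hmem : ∀ j ≤ n, v ∈ (G (n - j)).verts := by
    intro j
    induction j with
    | zero => exact fun _ => hv
    | succ j ih =>
      intro hj
      have h1 := hG (n - (j + 1)) (by omega)
      rw [show n - (j + 1) + 1 = n - j by omega] at h1
      exact h1.1.1 (ih (by omega))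
  have hmem' : ∀ i ≤ n, v ∈ (G i).verts := fun i hi => by
    have := hmem (n - i) (Nat.sub_le _ _)
    rwa [Nat.sub_sub_self hi] at this
  have hacy : ∀ i ≤ n, (G i).Acyclic := by
    intro i
    induction i with
    | zero => exact fun _ => hac
    | succ i ih => exact fun hi => (hG i hi).1.acyclic (ih (by omega))
  have hdiv : ∀ x y : ℝ, x ≤ 4 * γ * y → 1 / (4 * γ) * x ≤ y := by
    intro x y h
    rw [div_mul_eq_mul_div, one_mul, div_le_iff₀ (by positivity)]
    linarith
  exact
    { start := hsm v (hmem' 0 (Nat.zero_le _))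
      pos := fun i hi => Finset.card_pos.2 ⟨v, self_mem_anc (hmem' i hi)⟩
      le_edges := fun i _ => (G i).card_anc_le v
      edges_le := fun i hi => two_mul_card_ancEdges_le (hacy i hi) v
      anti_a := fun i hi => Finset.card_le_card ((hG i hi).1.anc_subset v)
      anti_e := fun i hi => Finset.card_le_card ((hG i hi).1.ancEdges_subset v)
      step := fun i hi => ((hG i hi).2 v (hmem' i hi.le)).imp (hdiv _ _) fun h =>
        ⟨Finset.card_pos.2 (Finset.nonempty_iff_ne_empty.2 h.1), hdiv _ _ h.2⟩ }

/-- The total cost of the batches of a run is `O(ρ log ρ / log (1/4γ))`. -/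
lemma sum_batchCost_le {γ : ℝ} {ρ : ℕ} (hρ : 1 < ρ) (hγ₁ : 1 / (16 * (ρ : ℝ) ^ 2) ≤ γ)
    (hγ₂ : γ < 1 / 4) {H : FinDigraph V} (hH : H.Acyclic) (hsm : H.IsSmall ρ)
    {l : List (FinDigraph V)} (hhead : ∀ G ∈ l.head?, G = H)
    (hchain : l.IsChain (GoodStep γ)) (hne : ∀ G ∈ l, G.verts.Nonempty) :
    (((l.map (batchCost ρ)).sum : ℕ) : ℝ) ≤ 12 * ρ * Real.logb (1 / (4 * γ)) (2 * ρ) := by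
  have hρ' : (2 : ℝ) ≤ ρ := by exact_mod_cast hρ
  have hγ : 0 < γ := lt_of_lt_of_le (by positivity) hγ₁
  set g := 1 / (4 * γ) with hgdef
  have hg : 1 < g := by rw [hgdef, lt_div_iff₀ (by positivity)]; linarith
  -- This is the lower bound on `γ`; equivalently `log_g(2ρ) ≥ 1/2`.
  have hgR : g ≤ (2 * ρ : ℝ) ^ 2 := by
    rw [hgdef, div_le_iff₀ (by positivity)]
    rw [div_le_iff₀ (by positivity)] at hγ₁
    nlinarith
  have hlog : ∀ n k : ℕ, g ^ n ≤ (2 * ρ : ℝ) ^ k → (n : ℝ) ≤ k * Real.logb g (2 * ρ) := by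
    intro n k h
    have h1 := Real.logb_le_logb_of_le hg (by positivity) h
    rwa [Real.logb_pow, Real.logb_pow, Real.logb_self_eq_one hg, mul_one] at h1
  have hx : 1 ≤ 2 * Real.logb g (2 * ρ) := by
    have := hlog 1 2 (by simpa using hgR)
    simpa using this
  rcases l with _ | ⟨A, l⟩
  · simp only [List.map_nil, List.sum_nil, Nat.cast_zero]
    have : 0 ≤ Real.logb g (2 * ρ) := by linarith
    positivity
  obtain rfl : A = H := hhead A rfl
  set L := A :: l with hL
  set G : ℕ → FinDigraph V := fun i => L.getD i A with hGdef
  have hGi : ∀ i (hi : i < L.length), G i = L[i] := fun i hi => List.getD_eq_getElem _ _ hi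
  have hstep : ∀ i, i + 1 < L.length → GoodStep γ (G i) (G (i + 1)) := by
    intro i hi
    rw [hGi i (by omega), hGi (i + 1) hi]
    exact List.isChain_iff_getElem.1 hchain i hi
  have hseq : ∀ n, n < L.length → ∀ v ∈ (G n).verts,
      ShrinkSeq g ρ n (fun i => ((G i).anc v).card) (fun i => ((G i).ancEdges v).card) :=
    fun n hn v hv => shrinkSeq_of_goodStep hγ hH hsm (fun i hi => hstep i (by omega)) hv
  have hsub : ∀ i < L.length, (G i).IsSmall ρ := by
    intro i
    induction i with
    | zero => exact fun _ => hsm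
    | succ i ih => exact fun hi => (hstep i hi).1.isSmall (ih (by omega))
  have hcost : ∀ C ∈ L.map (batchCost ρ), C ≤ 3 * ρ := by
    intro C hC
    obtain ⟨K, hK, rfl⟩ := List.mem_map.1 hC
    obtain ⟨i, hi, rfl⟩ := List.getElem_of_mem hK
    have : (L[i].verts.sup fun v => (L[i].anc v).card) ≤ 2 * ρ :=
      Finset.sup_le fun v hv => by have := hsub i hi; rw [hGi i hi] at this; exact this v hv
    rw [batchCost]; omega
  have hlen : L.length = l.length + 1 := rfl
  have hlast : l.length < L.length := by omega
  obtain ⟨v, hv⟩ : (G l.length).verts.Nonempty := by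
    rw [hGi _ hlast]; exact hne _ (List.getElem_mem _)
  rcases (hseq _ hlast v hv).length_cases hg hρ hgR with h | ⟨h2, h3⟩
  -- There are `l.length + 1` batches, since the last graph's vertex survived only the earlier ones.
  -- At most `4 log_g(2ρ)` batches cost `3ρ` each.
  · have h1 := hlog _ 4 h
    have h2 := List.sum_le_card_nsmul _ _ hcost
    rw [List.length_map, smul_eq_mul, hlen] at h2
    have h3 : (((L.map (batchCost ρ)).sum : ℕ) : ℝ) ≤ ((l.length + 1 : ℕ) : ℝ) * (3 * ρ) := by
      exact_mod_cast h2
    rw [Nat.cast_add, Nat.cast_one] at h1 h3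
    push_cast at h1
    nlinarith
  -- Three batches cost at most `3ρ + (2ρ - 1) + (ρ + 1) = 6ρ`, which is at most `12ρ log_g(2ρ)`.
  · obtain ⟨B, C, rfl⟩ : ∃ B C, l = [B, C] := List.length_eq_two.1 h2
    have hA : batchCost ρ A ≤ 3 * ρ := hcost _ (by simp [hL])
    have hB : batchCost ρ B ≤ 2 * ρ - 1 := by
      have : (B.verts.sup fun v => (B.anc v).card) ≤ ρ - 1 := Finset.sup_le fun w hw => by
        have h4 : ((G 1).anc w).card + 1 ≤ ρ :=
          ((hseq 1 (by simp [hL]) w hw).small_after_one hg hρ h3).2.2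
        exact Nat.le_sub_of_add_le h4
      rw [batchCost]; omega
    have hC : batchCost ρ C ≤ ρ + 1 := by
      have : (C.verts.sup fun v => (C.anc v).card) ≤ 1 := Finset.sup_le fun w hw =>
        (hseq 2 (by simp [hL]) w hw).small_after_two hg hρ h3
      rw [batchCost]; omega
    have hsum : (L.map (batchCost ρ)).sum ≤ 6 * ρ := by
      simp only [hL, List.map_cons, List.map_nil, List.sum_cons, List.sum_nil]
      omega
    have hsum' : (((L.map (batchCost ρ)).sum : ℕ) : ℝ) ≤ 6 * ρ := by exact_mod_cast hsum
    nlinarith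

end Chains

/-! ### Greedy list scheduling with duplication -/

section ListSchedule

variable {V : Type*} [DecidableEq V] {M : ℕ}

lemma mem_placeList {m m' : Fin M} {s t : ℕ} {v : V} {l : List V} :
    (m', v, t) ∈ placeList m s l ↔
      m' = m ∧ ∃ i, ∃ hi : i < l.length, l[i] = v ∧ t = s + i + 1 := by
  simp only [placeList, List.mem_toFinset, List.mem_map, Prod.exists, Prod.mk.injEq]
  constructor
  · rintro ⟨w, i, hwi, rfl, rfl, rfl⟩
    obtain ⟨hi, hw⟩ := List.getElem?_eq_some_iff.1 (List.mk_mem_zipIdx_iff_getElem?.1 hwi)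
    exact ⟨rfl, i, hi, hw, rfl⟩
  · rintro ⟨rfl, i, hi, rfl, rfl⟩
    exact ⟨l[i], i, List.mk_mem_zipIdx_iff_getElem?.2 (List.getElem?_eq_getElem hi), rfl, rfl, rfl⟩

variable [NeZero M]

lemma leastLoaded_le (load : Fin M → ℕ) (m : Fin M) : load (leastLoaded load) ≤ load m :=
  Classical.choose_spec (Finite.exists_min load) m

/-- What the list schedule of a batch does. -/
structure ListScheduleSpec (H : FinDigraph V) (B : List V) (free : Fin M → ℕ)
    (r : Finset (Fin M × V × ℕ) × (Fin M → ℕ)) : Prop where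
  free_le : ∀ m, free m ≤ r.2 m
  time : ∀ m v t, (m, v, t) ∈ r.1 → free m < t ∧ t ≤ r.2 m
  mem : ∀ m v t, (m, v, t) ∈ r.1 → v ∈ H.ancSet B.toFinset
  covers : ∀ v ∈ H.ancSet B.toFinset, ∃ m t, (m, v, t) ∈ r.1
  exclusive : ∀ m v w t, (m, v, t) ∈ r.1 → (m, w, t) ∈ r.1 → v = w
  precedence : ∀ m v t, (m, v, t) ∈ r.1 → ∀ u, H.Adj u v → ∃ t' < t, (m, u, t') ∈ r.1

/-- Each unit contains all predecessors of its jobs, so within a batch no communication between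
machines is needed. -/
lemma listSchedule_spec {H : FinDigraph V} (hH : H.Acyclic) (B : List V) :
    ∀ free : Fin M → ℕ, ListScheduleSpec H B free (listSchedule H B free) := by
  induction B with
  | nil =>
    intro free
    exact ⟨fun _ => le_rfl, by simp [listSchedule], by simp [listSchedule],
      by simp [mem_ancSet], by simp [listSchedule], by simp [listSchedule]⟩
  | cons w B ih =>
    intro free
    set m₀ := leastLoaded free with hm₀
    set free' := Function.update free m₀ (free m₀ + (H.anc w).card) with hfree'
    set r := listSchedule H B free' with hr
    have hrec : listSchedule H (w :: B) free =
        (placeList m₀ (free m₀) (H.ancList w) ∪ r.1, r.2) := rfl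
    obtain ⟨i1, i2, i3, i4, i5, i6⟩ := ih free'
    rw [← hr] at i1 i2 i3 i4 i5 i6
    have hle : ∀ m, free m ≤ free' m := by
      intro m
      by_cases h : m = m₀
      · subst h; rw [hfree', Function.update_self]; omega
      · rw [hfree', Function.update_of_ne h]
    have hself : free' m₀ = free m₀ + (H.anc w).card := Function.update_self ..
    have hplace : ∀ m v t, (m, v, t) ∈ placeList m₀ (free m₀) (H.ancList w) →
        m = m₀ ∧ free m < t ∧ t ≤ free' m ∧ v ∈ H.anc w := by
      intro m v t h
      obtain ⟨rfl, i, hi, rfl, rfl⟩ := mem_placeList.1 h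
      refine ⟨rfl, by omega, ?_, mem_ancList.1 (List.getElem_mem hi)⟩
      rw [length_ancList] at hi
      rw [hself]; omega
    have hanc : H.ancSet (w :: B).toFinset = H.anc w ∪ H.ancSet B.toFinset := by
      rw [List.toFinset_cons, ancSet_insert]
    rw [hrec]
    refine ⟨fun m => (hle m).trans (i1 m), ?_, ?_, ?_, ?_, ?_⟩
    · intro m v t h
      rcases Finset.mem_union.1 h with h | h
      · obtain ⟨-, h1, h2, -⟩ := hplace m v t h
        exact ⟨h1, h2.trans (i1 m)⟩
      · exact ⟨(hle m).trans_lt (i2 m v t h).1, (i2 m v t h).2⟩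
    · intro m v t h
      rw [hanc, Finset.mem_union]
      exact (Finset.mem_union.1 h).imp (fun h => (hplace m v t h).2.2.2) (i3 m v t)
    · intro v hv
      rw [hanc, Finset.mem_union] at hv
      rcases hv with hv | hv
      · obtain ⟨i, hi, hiv⟩ := List.getElem_of_mem (mem_ancList.2 hv)
        exact ⟨m₀, _, Finset.mem_union_left _ (mem_placeList.2 ⟨rfl, i, hi, hiv, rfl⟩)⟩
      · obtain ⟨m, t, h⟩ := i4 v hv
        exact ⟨m, t, Finset.mem_union_right _ h⟩
    · intro m v v' t h h'
      rcases Finset.mem_union.1 h with h | h <;> rcases Finset.mem_union.1 h' with h' | h'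
      · obtain ⟨-, i, hi, rfl, hti⟩ := mem_placeList.1 h
        obtain ⟨-, j, hj, rfl, htj⟩ := mem_placeList.1 h'
        have : i = j := by omega
        subst this; rfl
      · have h1 := (hplace m v t h).2.2.1
        have h2 := (i2 m v' t h').1
        omega
      · have h1 := (hplace m v' t h').2.2.1
        have h2 := (i2 m v t h).1
        omega
      · exact i5 m v v' t h h'
    · intro m v t h u huv
      rcases Finset.mem_union.1 h with h | h
      · obtain ⟨rfl, j, hj, hjv, rfl⟩ := mem_placeList.1 h
        obtain ⟨i, hi, hij, hiu⟩ := exists_lt_of_adj hH huv hj hjv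
        exact ⟨_, by omega, Finset.mem_union_left _ (mem_placeList.2 ⟨rfl, i, hi, hiu, rfl⟩)⟩
      · obtain ⟨t', ht', h'⟩ := i6 m v t h u huv
        exact ⟨t', ht', Finset.mem_union_right _ h'⟩

/-- Greedy list scheduling exceeds the average load by at most one unit. -/
lemma listSchedule_load {H : FinDigraph V} {c : ℕ} (B : List V)
    (hc : ∀ v ∈ B, (H.anc v).card ≤ c) :
    ∀ free : Fin M → ℕ, (∀ m, M * free m ≤ ∑ i, free i + M * c) →
      ∀ m, M * (listSchedule H B free).2 m ≤
        ∑ i, free i + (B.map fun v => (H.anc v).card).sum + M * c := by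
  induction B with
  | nil => exact fun free h m => by simpa [listSchedule] using h m
  | cons w B ih =>
    intro free h m
    set m₀ := leastLoaded free with hm₀
    set free' := Function.update free m₀ (free m₀ + (H.anc w).card) with hfree'
    have hrec : (listSchedule H (w :: B) free).2 = (listSchedule H B free').2 := rfl
    have hsum : ∑ i, free' i = ∑ i, free i + (H.anc w).card := by
      have h1 := Finset.sum_update_of_mem (Finset.mem_univ m₀) free (free m₀ + (H.anc w).card)
      have h2 := Finset.add_sum_erase Finset.univ free (Finset.mem_univ m₀)
      rw [Finset.sdiff_singleton_eq_erase] at h1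
      rw [hfree', h1]; omega
    -- The least loaded machine is at or below the average, so adding one unit of size at most `c`
    -- keeps it within `c` of the new average. On the other machines the gap only narrows.
    have hmin : M * free m₀ ≤ ∑ i, free i := by
      have := Finset.card_nsmul_le_sum Finset.univ free (free m₀)
        fun i _ => leastLoaded_le free i
      simpa using this
    have hcw := hc w (by simp)
    have := ih (fun v hv => hc v (List.mem_cons_of_mem _ hv)) free' (fun i => by
      rw [hsum]
      by_cases hi : i = m₀
      · subst hi
        rw [hfree', Function.update_self, mul_add]
        have := Nat.mul_le_mul_left M hcw
        omega
      · rw [hfree', Function.update_of_ne hi]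
        have := h i
        omega) m
    rw [hrec]
    simp only [List.map_cons, List.sum_cons]
    omega

end ListSchedule

/-! ### Assembling the batches into one schedule -/

section ScheduleLoop

variable {V : Type*} [DecidableEq V] {M : ℕ} [NeZero M]

/-- What is added to a schedule `σ` of length `T` by a successful run on `H`. -/
def GoodRun (H : FinDigraph V) (ρ : ℕ) (γ : ℝ) (σ : Finset (Fin M × V × ℕ)) (T : ℕ)
    (r : Finset (Fin M × V × ℕ) × ℕ) : Prop :=
  ∃ (τ : Finset (Fin M × V × ℕ)) (l : List (FinDigraph V)),
    r.1 = σ ∪ τ ∧ Feasible H ρ τ ∧ (∀ m v t, (m, v, t) ∈ τ → T < t ∧ t ≤ r.2) ∧ T ≤ r.2 ∧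
    (∀ G ∈ l.head?, G = H) ∧ l.IsChain (GoodStep γ) ∧ (∀ G ∈ l, G.verts.Nonempty) ∧
    (r.2 : ℝ) ≤ T + H.verts.card / (γ * M) + ((l.map (batchCost ρ)).sum : ℕ)

lemma goodRun_of_verts_eq_empty {H : FinDigraph V} (hH : H.verts = ∅) (ρ : ℕ) (γ : ℝ)
    (σ : Finset (Fin M × V × ℕ)) (T : ℕ) : GoodRun H ρ γ σ T (σ, T) := by
  refine ⟨∅, [], by simp, ⟨by simp, by simp [hH], by simp, by simp⟩, by simp, le_rfl,
    by simp, by simp, by simp, by simp [hH]⟩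

/-- A feasible schedule of the remaining graph can follow the schedule of a batch. -/
lemma feasible_union {H : FinDigraph V} {ρ : ℕ} {B : List V} {T T' : ℕ}
    {r : Finset (Fin M × V × ℕ) × (Fin M → ℕ)}
    (hr : ListScheduleSpec H B (fun _ => T) r) (hT : ∀ m, r.2 m ≤ T')
    {τ : Finset (Fin M × V × ℕ)} (hτ : Feasible (residual H B) ρ τ)
    (hτT : ∀ m v t, (m, v, t) ∈ τ → T' + ρ < t) : Feasible H ρ (r.1 ∪ τ) where
  mem m v t h := by
    rcases Finset.mem_union.1 h with h | h
    · exact ⟨H.ancSet_subset_verts _ (hr.mem m v t h), by have := (hr.time m v t h).1; omega⟩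
    · exact ⟨(mem_verts_delete.1 (hτ.mem m v t h).1).1, (hτ.mem m v t h).2⟩
  covers v hv := by
    by_cases h : v ∈ H.ancSet B.toFinset
    · obtain ⟨m, t, h⟩ := hr.covers v h
      exact ⟨m, t, Finset.mem_union_left _ h⟩
    · obtain ⟨m, t, h⟩ := hτ.covers v (mem_verts_delete.2 ⟨hv, h⟩)
      exact ⟨m, t, Finset.mem_union_right _ h⟩
  exclusive m v w t h h' := by
    rcases Finset.mem_union.1 h with h | h <;> rcases Finset.mem_union.1 h' with h' | h'
    · exact hr.exclusive m v w t h h'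
    · have h1 := (hr.time m v t h).2
      have h2 := hT m
      have h3 := hτT m w t h'
      omega
    · have h1 := (hr.time m w t h').2
      have h2 := hT m
      have h3 := hτT m v t h
      omega
    · exact hτ.exclusive m v w t h h'
  precedence m v t h u huv := by
    rcases Finset.mem_union.1 h with h | h
    · obtain ⟨t', ht', h'⟩ := hr.precedence m v t h u huv
      exact .inl ⟨t', ht', Finset.mem_union_left _ h'⟩
    -- A predecessor deleted with the batch ran by slot `T'`, more than `ρ` slots earlier thanks to
    -- the idle time, so its machine is immaterial.
    · by_cases hu : u ∈ H.ancSet B.toFinset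
      · obtain ⟨m', t', h'⟩ := hr.covers u hu
        have h1 := (hr.time m' u t' h').2
        have h2 := hT m'
        have h3 := hτT m v t h
        exact .inr ⟨m', t', by omega, Finset.mem_union_left _ h'⟩
      · have hv := (mem_verts_delete.1 (hτ.mem m v t h).1).2
        refine (hτ.precedence m v t h u (delete_adj.2 ⟨huv, hu, hv⟩)).imp ?_ ?_
        · rintro ⟨t', ht', h'⟩
          exact ⟨t', ht', Finset.mem_union_right _ h'⟩
        · rintro ⟨m', t', ht', h'⟩
          exact ⟨m', t', ht', Finset.mem_union_right _ h'⟩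

lemma card_residual_add (H : FinDigraph V) (B : List V) :
    (residual H B).verts.card + (H.ancSet B.toFinset).card = H.verts.card :=
  Finset.card_sdiff_add_card_eq_card (H.ancSet_subset_verts _)

lemma GoodBatch.card_ancSet_pos {H : FinDigraph V} {γ : ℝ} {B : List V} (hB : GoodBatch H γ B) :
    0 < (H.ancSet B.toFinset).card := by
  obtain ⟨v, hv⟩ := List.exists_mem_of_ne_nil B hB.ne_nil
  exact Finset.card_pos.2 ⟨v, mem_ancSet.2 ⟨v, List.mem_toFinset.2 hv,
    self_mem_anc (hB.fresh.mem_verts hv)⟩⟩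

/-- The length of the schedule of a good batch. -/
lemma GoodBatch.schedule_length_le {H : FinDigraph V} {γ : ℝ} (hγ : 0 < γ) {B : List V}
    (hB : GoodBatch H γ B) (T : ℕ) :
    ((Finset.univ.sup (listSchedule H B fun _ : Fin M => T).2 : ℕ) : ℝ) ≤
      T + (H.ancSet B.toFinset).card / (γ * M) +
        (H.verts.sup fun v => (H.anc v).card : ℕ) := by
  set c := H.verts.sup fun v => (H.anc v).card with hcdef
  have hM : (0 : ℝ) < M := by exact_mod_cast NeZero.pos M
  obtain ⟨m, -, hm⟩ := Finset.exists_mem_eq_sup (Finset.univ : Finset (Fin M))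
    ⟨⟨0, NeZero.pos M⟩, Finset.mem_univ _⟩ (listSchedule H B fun _ : Fin M => T).2
  rw [hm]
  have h1 := listSchedule_load (H := H) (c := c) B
    (fun v hv => Finset.le_sup (f := fun v => (H.anc v).card) (hB.fresh.mem_verts hv))
    (fun _ : Fin M => T) (by simp) m
  set x := (listSchedule H B fun _ : Fin M => T).2 m
  have h2 := hB.fresh.sum_card_le
  set S := (B.map fun v => (H.anc v).card).sum
  simp only [Finset.sum_const, Finset.card_univ, Fintype.card_fin, smul_eq_mul] at h1
  have h1' : (M : ℝ) * x ≤ M * T + S + M * c := by exact_mod_cast h1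
  have h3 : (S : ℝ) ≤ M * ((H.ancSet B.toFinset).card / (γ * M)) := by
    rw [← mul_div_assoc, le_div_iff₀ (by positivity)]
    nlinarith
  have h4 : (M : ℝ) * x ≤ M * (T + (H.ancSet B.toFinset).card / (γ * M) + c) := by
    rw [mul_add, mul_add]; linarith
  exact le_of_mul_le_mul_left h4 hM

/-- A successful run of the whole algorithm has the claimed properties. -/
lemma GoodRun.conclusion {H : FinDigraph V} (hH : H.Acyclic) {ρ : ℕ} (hρ : 1 < ρ)
    (hsm : H.IsSmall ρ) {γ : ℝ} (hγ₁ : 1 / (16 * (ρ : ℝ) ^ 2) ≤ γ) (hγ₂ : γ < 1 / 4)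
    {r : Finset (Fin M × V × ℕ) × ℕ} (h : GoodRun H ρ γ ∅ 0 r) :
    Feasible H ρ r.1 ∧ makespan r.1 ≤ r.2 ∧
      (r.2 : ℝ) ≤ (H.verts.card : ℝ) / (γ * M) +
        12 * ρ * Real.logb (1 / (4 * γ)) (2 * ρ) := by
  obtain ⟨τ, l, h1, h2, h3, -, h5, h6, h7, h8⟩ := h
  rw [Finset.empty_union] at h1
  rw [h1]
  refine ⟨h2, Finset.sup_le fun e he => (h3 _ _ _ he).2, ?_⟩
  have := sum_batchCost_le hρ hγ₁ hγ₂ hH hsm h5 h6 h7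
  rw [Nat.cast_zero] at h8
  linarith

variable [Fintype V]

/-- A good batch deletes at least one job, so the fuel covers the run and bounds the number of calls
that can fail. The chain of residual graphs is recorded in `GoodRun`, so that the number of batches
can be bounded afterwards without probability. -/
lemma failProb_scheduleLoop_le {P : EstimatorParams V} {δ : ℝ≥0∞}
    (hδ : ∀ G : FinDigraph V, failProb (obtainEstimates P G) (GoodEstimates G) ≤ δ)
    {ρ : ℕ} {γ : ℝ} (hγ : 0 < γ) (hγ1 : γ < 1) {N : ℕ} (hN : 1 ≤ N) (fuel : ℕ) :
    ∀ (H : FinDigraph V) (σ : Finset (Fin M × V × ℕ)) (T : ℕ), H.Acyclic →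
      H.verts.card ≤ fuel →
      failProb (scheduleLoop P ρ γ N fuel H σ T) (GoodRun H ρ γ σ T) ≤
        fuel * (Fintype.card V * (2 * δ)) := by
  induction fuel with
  | zero =>
    intro H σ T _ hc
    rw [scheduleLoop, failProb_eq_zero]
    · exact zero_le
    · intro r hr
      rw [PMF.mem_support_pure_iff] at hr
      subst hr
      exact goodRun_of_verts_eq_empty (Finset.card_eq_zero.1 (by omega)) ρ γ σ T
  | succ fuel ih =>
    intro H σ T hH hc
    rw [scheduleLoop]
    split_ifs with hne
    · push_cast
      rw [add_mul, one_mul, add_comm]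
      refine failProb_bind_le (failProb_findBatch_le hδ hne hγ.le hγ1 hN) fun B _ hB => ?_
      have hcard := card_residual_add H B
      have hpos := hB.card_ancSet_pos
      have hsub : (residual H B).IsSubgraph H := H.delete_isSubgraph _
      refine le_trans (failProb_mono ?_) (ih (residual H B) _ _ (hsub.acyclic hH) (by omega))
      set s := listSchedule H B fun _ : Fin M => T with hs
      set T' := Finset.univ.sup s.2 with hT'
      have hspec : ListScheduleSpec H B (fun _ : Fin M => T) s := listSchedule_spec hH B _
      have hsT : ∀ m, s.2 m ≤ T' := fun m => Finset.le_sup (Finset.mem_univ m)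
      have hTT' : T ≤ T' := (hspec.free_le ⟨0, NeZero.pos M⟩).trans (hsT _)
      rintro r - ⟨τ, l, h1, h2, h3, h4, h5, h6, h7, h8⟩
      refine ⟨s.1 ∪ τ, H :: l, by rw [h1, Finset.union_assoc],
        feasible_union hspec hsT h2 fun m v t h => (h3 m v t h).1, ?_, by omega, ?_, ?_, ?_, ?_⟩
      · intro m v t h
        rcases Finset.mem_union.1 h with h | h
        · have := hspec.time m v t h
          have := hsT m
          omega
        · have := h3 m v t h
          omega
      · simp
      · rw [List.isChain_cons]
        exact ⟨fun G hG => by rw [h5 G hG]; exact ⟨hsub, hB.reduced⟩, h6⟩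
      · intro G hG
        rcases List.mem_cons.1 hG with rfl | hG
        · exact hne
        · exact h7 G hG
      · have hlen := hB.schedule_length_le (M := M) hγ T
        rw [← hs, ← hT'] at hlen
        have hcard' : (H.verts.card : ℝ) =
            (residual H B).verts.card + (H.ancSet B.toFinset).card := by
          exact_mod_cast hcard.symm
        rw [hcard', add_div, List.map_cons, List.sum_cons, batchCost]
        rw [Nat.cast_add] at h8
        rw [Nat.cast_add, Nat.cast_add]
        linarith
    · rw [failProb_eq_zero]
      · exact zero_le
      · intro r hr
        rw [PMF.mem_support_pure_iff] at hr
        subst hr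
        exact goodRun_of_verts_eq_empty (Finset.not_nonempty_iff_eq_empty.1 hne) ρ γ σ T

end ScheduleLoop

/-! ### Final probability bound -/

section Main

lemma one_sub_le_of_failProb_le {α : Type*} {p : PMF α} {Q : α → Prop} {x : ℝ} (hx : 0 ≤ x)
    (h : failProb p Q ≤ ENNReal.ofReal x) : 1 - x ≤ (p.toOuterMeasure {a | Q a}).toReal := by
  have h1 : (1 : ℝ≥0∞) ≤ p.toOuterMeasure {a | Q a} + ENNReal.ofReal x := by
    refine le_trans ?_ (add_le_add_right h _)
    have h2 : p.toOuterMeasure Set.univ = 1 := by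
      rw [PMF.toOuterMeasure_apply_eq_one_iff]; exact Set.subset_univ _
    rw [← h2, failProb]
    refine le_trans (le_of_eq ?_) (MeasureTheory.measure_union_le {a | Q a} {a | ¬ Q a})
    congr 1
    ext a
    simp [em]
  have hne : p.toOuterMeasure {a | Q a} ≠ ∞ := by
    have := failProb_le_one p fun a => ¬ Q a
    simp only [failProb, not_not] at this
    exact ne_top_of_le_ne_top ENNReal.one_ne_top this
  rw [← ENNReal.ofReal_toReal hne, ← ENNReal.ofReal_add ENNReal.toReal_nonneg hx,
    ENNReal.one_le_ofReal] at h1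
  linarith

/-- With `(c + 5) / log (12/11) * log n` hash functions the error of one estimate, multiplied by
the number of estimates, is at most `n ^ (-c)`. -/
lemma amplified_error_le {n K : ℕ} (hn : 2 ≤ n) {c : ℝ}
    (hK : (c + 5) / Real.log (12 / 11) * Real.log n ≤ K) :
    (4 * (n : ℝ) ^ 3) * (11 / 12) ^ K ≤ 1 / (n : ℝ) ^ c := by
  have hn' : (2 : ℝ) ≤ n := by exact_mod_cast hn
  have hn0 : (0 : ℝ) < n := by linarith
  have hlog : 0 < Real.log (12 / 11) := Real.log_pos (by norm_num)
  have h1 : (11 / 12 : ℝ) ^ K ≤ (n : ℝ) ^ (-(c + 5)) := by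
    have h2 : (11 / 12 : ℝ) ^ K = Real.exp (-(Real.log (12 / 11) * K)) := by
      rw [← Real.rpow_natCast, Real.rpow_def_of_pos (by norm_num),
        show (11 / 12 : ℝ) = (12 / 11)⁻¹ by norm_num, Real.log_inv, neg_mul]
    rw [h2, Real.rpow_def_of_pos hn0]
    refine Real.exp_le_exp.2 ?_
    rw [div_mul_eq_mul_div, div_le_iff₀ hlog] at hK
    linarith
  -- The surplus `n^(-5)` absorbs the `4n³` of the union bound: `4/n² ≤ 1` for `n ≥ 2`.
  have h3 : (n : ℝ) ^ (-(c + 5)) = 1 / (n : ℝ) ^ c * (1 / (n : ℝ) ^ 5) := by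
    rw [neg_add, Real.rpow_add hn0, Real.rpow_neg hn0.le, Real.rpow_neg hn0.le, one_div, one_div]
    norm_cast
  have h4 : 0 < (n : ℝ) ^ c := Real.rpow_pos_of_pos hn0 c
  calc (4 * (n : ℝ) ^ 3) * (11 / 12) ^ K
      ≤ (4 * (n : ℝ) ^ 3) * (1 / (n : ℝ) ^ c * (1 / (n : ℝ) ^ 5)) := by
        rw [← h3]; exact mul_le_mul_of_nonneg_left h1 (by positivity)
    _ = 1 / (n : ℝ) ^ c * (4 / (n : ℝ) ^ 2) := by field_simp
    _ ≤ 1 / (n : ℝ) ^ c * 1 := by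
        refine mul_le_mul_of_nonneg_left ?_ (by positivity)
        rw [div_le_one (by positivity)]
        nlinarith
    _ = _ := mul_one _

variable {V : Type*} [Fintype V] [DecidableEq V] {M : ℕ} [NeZero M]

/-- The factor `4n³` is `n` batches times `n` pruning rounds times 2 calls times `2n` estimates. -/
lemma failProb_scheduleSmallSubgraph_le (hV : 2 ≤ Fintype.card V) {P : EstimatorParams V}
    (ht : 1000 ≤ P.treeSize) {c : ℝ}
    (hK : (c + 5) / Real.log (12 / 11) * Real.log (Fintype.card V) ≤ P.numHashes)
    {N : ℕ} (hN : 1 ≤ N) (ρ : ℕ) {γ : ℝ} (hγ : 0 < γ) (hγ1 : γ < 1) {H : FinDigraph V}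
    (hH : H.Acyclic) :
    failProb (scheduleSmallSubgraph M P ρ γ N H) (GoodRun H ρ γ ∅ 0) ≤
      ENNReal.ofReal (1 / (Fintype.card V : ℝ) ^ c) := by
  refine (failProb_scheduleLoop_le (failProb_obtainEstimates_le hV P ht) hγ hγ1 hN _ H ∅ 0 hH
    le_rfl).trans ?_
  refine le_trans ?_ (ENNReal.ofReal_le_ofReal (amplified_error_le hV hK))
  rw [ENNReal.ofReal_mul (by positivity)]
  have h1 : ENNReal.ofReal (4 * (Fintype.card V : ℝ) ^ 3) = 4 * (Fintype.card V : ℝ≥0∞) ^ 3 := by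
    rw [ENNReal.ofReal_mul (by norm_num), ENNReal.ofReal_pow (by positivity),
      ENNReal.ofReal_natCast, ENNReal.ofReal_ofNat]
  rw [h1]
  set d := ENNReal.ofReal ((11 / 12) ^ P.numHashes)
  calc (H.verts.card : ℝ≥0∞) * (Fintype.card V * (2 * (2 * Fintype.card V * d)))
      ≤ (Fintype.card V : ℝ≥0∞) * (Fintype.card V * (2 * (2 * Fintype.card V * d))) := by
        gcongr; exact Finset.card_le_univ _
    _ = 4 * (Fintype.card V : ℝ≥0∞) ^ 3 * d := by ring

end Main

end CommDelay

end

theorem mainTheorem3 :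
    ∃ t₀ : ℕ, ∀ c : ℝ, 1 ≤ c → ∃ κ₀ : ℝ,
      ∀ (V : Type*) [Fintype V] [DecidableEq V]
        (P : CommDelay.EstimatorParams V)
        (_ht : t₀ ≤ P.treeSize) (_hK : κ₀ * Real.log (Fintype.card V) ≤ P.numHashes)
        (N : ℕ) (_hN : 1 ≤ N)
        (M : ℕ) [NeZero M] (ρ : ℕ) (_hρ : 1 < ρ)
        (γ : ℝ) (_hγ₁ : 1 / (16 * (ρ : ℝ) ^ 2) ≤ γ) (_hγ₂ : γ < 1 / 4)
        (H : CommDelay.FinDigraph V) (_hH : H.Acyclic) (_hsmall : H.IsSmall ρ),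
        1 - 1 / (Fintype.card V : ℝ) ^ c ≤
          ((CommDelay.scheduleSmallSubgraph M P ρ γ N H).toOuterMeasure
            {σ | CommDelay.Feasible H ρ σ.1 ∧ CommDelay.makespan σ.1 ≤ σ.2 ∧
              (σ.2 : ℝ) ≤ (H.verts.card : ℝ) / (γ * M) +
                12 * ρ * Real.logb (1 / (4 * γ)) (2 * ρ)}).toReal := by
  refine ⟨1000, fun c hc => ⟨(c + 5) / Real.log (12 / 11), ?_⟩⟩
  intro V _ _ P ht hK N hN M _ ρ hρ γ hγ₁ hγ₂ H hH hsmall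
  have hγ : 0 < γ := lt_of_lt_of_le (by positivity) hγ₁
  refine CommDelay.one_sub_le_of_failProb_le (by positivity) ?_
  refine (CommDelay.failProb_mono (Q := CommDelay.GoodRun H ρ γ ∅ 0) fun r _ h =>
    h.conclusion hH hρ hsmall hγ₁ hγ₂).trans ?_
  rcases Nat.lt_or_ge (Fintype.card V) 2 with hV | hV
  -- Uniformity of a single hash value is derived from a second element, so `n ≤ 1` is separate. For
  -- `n = 0` the bound reads `1 - 1/0 = 1` and the run must succeed surely, which it does on the
  -- empty graph; for `n = 1` the bound is 0.
  · rcases (by omega : Fintype.card V = 0 ∨ Fintype.card V = 1) with h0 | h1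
    · have hverts : H.verts = ∅ :=
        Finset.card_eq_zero.1 (Nat.le_zero.1 (h0 ▸ Finset.card_le_univ H.verts))
      rw [CommDelay.failProb_eq_zero]
      · exact zero_le
      · intro r hr
        rw [CommDelay.scheduleSmallSubgraph, hverts, Finset.card_empty, CommDelay.scheduleLoop,
          PMF.mem_support_pure_iff] at hr
        subst hr
        exact CommDelay.goodRun_of_verts_eq_empty hverts ρ γ ∅ 0
    · refine (CommDelay.failProb_le_one _ _).trans ?_
      rw [h1]
      simp
  · exact CommDelay.failProb_scheduleSmallSubgraph_le hV ht hK hN ρ hγ (by linarith) hH
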